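/- Let $n\ge 1$. In $\mathbb F_2(t)$ put $[m]=t^{2^m}-t$, $D_m=\prod_{0\le j<m}(t^{2^m}-t^{2^j})$ and $L_m=[m][m-1]\cdots[1]$ (so $D_0=L_0=1$), and let $A_n=\dfrac{[n-1]}{L_n\,[1]^{2^{n-1}}}$. Let $e_i$ and $p_m$ denote the elementary symmetric functions and the power sums (in arbitrarily many variables), and let $G_n=(p_{2^n-1}^2-p_{2(2^n-1)})/2$. Define polynomials $f_k$ and $X_m$ in the $e_i$ over $\mathbb F_2$ recursively by $$X_m=\sum_{k=0}^{m-2} e_{2^{m-k}-1}^{2^k}f_k,\qquad f_0=1,\qquad f_{k+1}=f_k e_1^{2^k}+X_{k+1}\quad(k\ge 0),$$ an empty sum being $0$. (I) There is exactly one polynomial in $\mathbb Z[e_1,e_2,\dots]$ that expresses $G_n$ through the elementary symmetric functions, in every finite number of variables. Let $Y_n$ be obtained from its reduction modulo $2$ by dropping all monomials that contain some $e_i$ with $i$ not of the form $2^k-1$. Then $Y_n=X_n^2$. Equivalently to the recursion above, $$X_n=\sum_{k=0}^{n-2}e_{2^{n-k}-1}^{2^k}\Bigl(e_1^{2^{k-1}+\cdots+2+1}+\sum_{j=1}^{k}e_1^{2^{k-1}+\cdots+2^j}X_j\Bigr),$$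 where an empty sum in an exponent is $0$. (II) Substituting $1/D_i$ for $e_{2^i-1}$ and $1/L_i$ for $f_i$ in the formula for $X_n$ gives $A_n$: $$\sum_{k=0}^{n-2}\frac{1}{D_{n-k}^{2^k}L_k}=A_n .$$ The two substitutions are compatible: substituting $1/D_i$ for every $e_{2^i-1}$ in the polynomial $f_k$ gives $1/L_k$, for every $k\ge 0$. (III) In the completion $\mathbb F_2((1/t))$ of $\mathbb F_2(t)$ at the place at infinity, the sum over all monic irreducible polynomials $\wp\in\mathbb F_2[t]$ converges and $$\sum_{\wp}\frac{1}{1-\wp^{2^n-1}}=\frac{[n-1]^2}{[1]^{2^n}} .$$ -/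

import Mathlib

open Finset Polynomial

noncomputable section

namespace PrimeSymmetry

section Formula

variable {R : Type*} [CommRing R]

/-- The formula `∑_{k=0}^{n-2} e_{2^{n-k}-1}^{2^k} f_k` as a function of the values of the two
sequences `e` and `f` (the sum is empty for `n ≤ 1`). -/
def xFormula (e f : ℕ → R) (n : ℕ) : R :=
  ∑ k ∈ range (n - 1), e (2 ^ (n - k) - 1) ^ 2 ^ k * f k

/-- The sequence `f_k` attached to `e`, defined by `f_0 = 1` and
`f_{k+1} = f_k e_1^{2^k} + X_{k+1}`, where the last sum below is `X_{k+1}` written out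
(see `fSeq_succ`). -/
def fSeq (e : ℕ → R) : ℕ → R
  | 0 => 1
  | k + 1 => fSeq e k * e 1 ^ 2 ^ k
      + ∑ j : Fin k, e (2 ^ (k + 1 - (j : ℕ)) - 1) ^ 2 ^ (j : ℕ) * fSeq e (j : ℕ)
termination_by k => k
decreasing_by all_goals omega

/-- `X_n = ∑_{k=0}^{n-2} e_{2^{n-k}-1}^{2^k} f_k`. -/
def xSeq (e : ℕ → R) (n : ℕ) : R :=
  xFormula e (fSeq e) n

theorem fSeq_zero (e : ℕ → R) : fSeq e 0 = 1 := by
  rw [fSeq]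

theorem fSeq_succ (e : ℕ → R) (k : ℕ) :
    fSeq e (k + 1) = fSeq e k * e 1 ^ 2 ^ k + xSeq e (k + 1) := by
  rw [fSeq, xSeq, xFormula, Nat.add_sub_cancel,
    ← Fin.sum_univ_eq_sum_range
      (fun j => e (2 ^ (k + 1 - j) - 1) ^ 2 ^ j * fSeq e j) k]

end Formula

section SymmetricFunctions

/-- The symbol `e_i` in the polynomial ring `R[e_1, e_2, e_3, …]`, with `e_0 = 1`. -/
def eVar (R : Type*) [CommRing R] (i : ℕ) : MvPolynomial ℕ+ R :=
  if h : 0 < i then MvPolynomial.X ⟨i, h⟩ else 1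

/-- `Q ∈ ℤ[e_1, e_2, …]` is a polynomial expression, in terms of the elementary symmetric
functions, for `(p_m ^ 2 - p_{2m}) / 2`, where `p_m` is the `m`-th power sum: the identity holds
after the elementary symmetric polynomials in any finite number `N` of variables are
substituted for the `e_i`. -/
def IsElementaryExpression (m : ℕ) (Q : MvPolynomial ℕ+ ℤ) : Prop :=
  ∀ N : ℕ,
    2 * MvPolynomial.aeval (fun i : ℕ+ => MvPolynomial.esymm (Fin N) ℤ (i : ℕ)) Q =
      MvPolynomial.psum (Fin N) ℤ m ^ 2 - MvPolynomial.psum (Fin N) ℤ (2 * m)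

open Classical in
/-- Drop from a polynomial in the `e_i` all monomials which contain some `e_i` with `i` not of
the form `2 ^ k - 1`. -/
def mersennePart {R : Type*} [CommRing R] (Q : MvPolynomial ℕ+ R) : MvPolynomial ℕ+ R :=
  ∑ s ∈ Q.support with ∀ i : ℕ+, i ∈ s.support → ∃ k : ℕ, (i : ℕ) = 2 ^ k - 1,
    MvPolynomial.monomial s (Q.coeff s)

end SymmetricFunctions

section Carlitz

/-- The field `K = 𝔽₂(t)`. -/
abbrev K : Type := RatFunc (ZMod 2)

/-- `[n] = t^{2^n} - t`. -/
def bracket (n : ℕ) : K :=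
  RatFunc.X ^ 2 ^ n - RatFunc.X

/-- `D_n = ∏_{0 ≤ j < n} (t^{2^n} - t^{2^j})`. -/
def carlitzD (n : ℕ) : K :=
  ∏ j ∈ range n, (RatFunc.X ^ 2 ^ n - RatFunc.X ^ 2 ^ j)

/-- `L_n = [n] [n-1] ⋯ [1]`. -/
def carlitzL (n : ℕ) : K :=
  ∏ j ∈ Icc 1 n, bracket j

open Classical in
/-- The completion `K_∞` of `𝔽₂(t)` at the place at infinity. -/
abbrev KInfty : Type := RatFunc.CompletionAtInfty (ZMod 2)

/-- The monic irreducible polynomials in `𝔽₂[t]`. -/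
abbrev MonicPrime : Type :=
  {P : (ZMod 2)[X] // P.Monic ∧ Irreducible P}

end Carlitz

end PrimeSymmetry

end

namespace PrimeSymmetry

/-! ### The recursion for f_k and its functoriality -/

section Formula

variable {R S : Type*} [CommRing R] [CommRing S]

/-! All three parts rest on one computation with a finite additive group V in characteristic 2.
Write P_k for the sum of a^{-(2^k-1)} over nonzero a in V (`invPowSum`). The identity 1/(ab) =
(1/(a+b))(1/a + 1/b), raised to the power 2^n and multiplied by ab, splits (ab)^{-(2^n-1)} into two
terms exchanged by a ↔ b. Summing over unordered pairs and substituting (a, b) ↦ (a+b, a), which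
permutes the ordered pairs of distinct nonzero elements, gives P_n^2 + P_{n-1}^2 P_1^{2^n} for the
pair sum (`sum_pairs_invPow`).

(I) Dropping the non-Mersenne e_i means evaluating G_n at points where they vanish. At such a point
∑ e_i y^{i+1} is an additive polynomial, so the variables are the inverses of the nonzero elements
of a group V (`exists_additive_roots`). The recursion for f makes ∑ f_k z^{2^k} a left compositional
inverse of ∑ e_{2^k-1} z^{2^k}; Newton's identities make ∑ P_k z^{2^k} a right inverse. Hence P_k =
f_k, and the pair sum is (f_n + f_{n-1} e_1^{2^{n-1}})^2 = X_n^2.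

(II) The values 1/L_k satisfy the recursion of f_k for e_{2^i-1} = 1/D_i, by [n] = [k] +
[n-k]^{2^k}.

(III) Take for V the polynomials of degree at most d; its nonzero elements are all monic. Among
unordered pairs {a, b} with a given product, exchanging the exponents of one prime cancels
everything mod 2 except the pairs {b, b℘^k} (`sum_precedes`). So, up to terms of large degree, the
pair sum is P_n^2 ∑_℘ ∑_{k≥1} ℘^{-k(2^n-1)}, and the inner series is 1/(1-℘^{2^n-1}) in
characteristic 2. Dividing by P_n^2, with P_n = L_{d+n}/(L_n L_d^{2^n}) (`invPowSum_polyLT`), and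
letting d grow gives the value. -/

theorem fSeq_succ_eq_sum (e : ℕ → R) (k : ℕ) :
    fSeq e (k + 1) = ∑ j ∈ range (k + 1), e (2 ^ (k + 1 - j) - 1) ^ 2 ^ j * fSeq e j := by
  rw [fSeq_succ, xSeq, xFormula, sum_range_succ, Nat.add_sub_cancel, Nat.add_sub_cancel_left]
  norm_num
  ring

/-- Uniqueness of the solution of the recursion; it yields both compatibility with ring
homomorphisms and the identification with 1/L_k. -/
theorem eq_fSeq {e g : ℕ → R} (h0 : g 0 = 1)
    (hs : ∀ k, g (k + 1) = ∑ j ∈ range (k + 1), e (2 ^ (k + 1 - j) - 1) ^ 2 ^ j * g j) (k : ℕ) :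
    g k = fSeq e k := by
  induction k using Nat.strong_induction_on with
  | _ k ih =>
    cases k with
    | zero => rw [h0, fSeq_zero]
    | succ k =>
      rw [hs, fSeq_succ_eq_sum]
      refine sum_congr rfl fun j hj => ?_
      rw [ih j (mem_range.1 hj)]

theorem map_fSeq (φ : R →+* S) (e : ℕ → R) (k : ℕ) :
    φ (fSeq e k) = fSeq (fun i => φ (e i)) k := by
  refine eq_fSeq (g := fun k => φ (fSeq e k)) ?_ (fun k => ?_) k
  · simp [fSeq_zero]
  · simp [fSeq_succ_eq_sum]

theorem map_xSeq (φ : R →+* S) (e : ℕ → R) (n : ℕ) :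
    φ (xSeq e n) = xSeq (fun i => φ (e i)) n := by
  simp [xSeq, xFormula, map_fSeq]

theorem fSeq_congr {e e' : ℕ → R} {n : ℕ}
    (h : ∀ i, 1 ≤ i → i ≤ n → e (2 ^ i - 1) = e' (2 ^ i - 1)) {k : ℕ} (hk : k ≤ n) :
    fSeq e k = fSeq e' k := by
  induction k using Nat.strong_induction_on with
  | _ k ih =>
    cases k with
    | zero => rw [fSeq_zero, fSeq_zero]
    | succ k =>
      rw [fSeq_succ_eq_sum, fSeq_succ_eq_sum]
      refine sum_congr rfl fun j hj => ?_
      have := mem_range.1 hj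
      rw [h _ (by omega) (by omega), ih j this (by omega)]

theorem xSeq_congr {e e' : ℕ → R} {n : ℕ}
    (h : ∀ i, 1 ≤ i → i ≤ n → e (2 ^ i - 1) = e' (2 ^ i - 1)) : xSeq e n = xSeq e' n := by
  rw [xSeq, xSeq, xFormula, xFormula]
  refine sum_congr rfl fun k hk => ?_
  have := mem_range.1 hk
  rw [h _ (by omega) (by omega), fSeq_congr h (by omega)]

theorem fSeq_eq_sum_xSeq (e : ℕ → R) (k : ℕ) :
    fSeq e k = e 1 ^ (∑ i ∈ range k, 2 ^ i) +
      ∑ j ∈ Icc 1 k, e 1 ^ (∑ i ∈ Ico j k, 2 ^ i) * xSeq e j := by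
  induction k with
  | zero => simp [fSeq_zero]
  | succ k ih =>
    rw [fSeq_succ, ih, sum_range_succ, pow_add, ← insert_Icc_right_eq_Icc_add_one (by omega),
      sum_insert (by simp), Ico_self, sum_empty, pow_zero, one_mul, add_mul, sum_mul]
    have : ∀ j ∈ Icc 1 k, e 1 ^ (∑ i ∈ Ico j (k + 1), 2 ^ i) * xSeq e j
        = e 1 ^ (∑ i ∈ Ico j k, 2 ^ i) * xSeq e j * e 1 ^ 2 ^ k := fun j hj => by
      rw [sum_Ico_succ_top (mem_Icc.1 hj).2, pow_add]
      ring
    rw [sum_congr rfl this]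
    ring

theorem xSeq_eq_sum (e : ℕ → R) (n : ℕ) :
    xSeq e n = ∑ k ∈ range (n - 1), e (2 ^ (n - k) - 1) ^ 2 ^ k *
      (e 1 ^ (∑ i ∈ range k, 2 ^ i) +
        ∑ j ∈ Icc 1 k, e 1 ^ (∑ i ∈ Ico j k, 2 ^ i) * xSeq e j) := by
  rw [xSeq, xFormula]
  simp_rw [← fSeq_eq_sum_xSeq]

end Formula

/-! ### Carlitz factorials and the substitution of part (II) -/

section Carlitz

instance : CharP K 2 := charP_of_injective_algebraMap (algebraMap (ZMod 2) K).injective 2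

theorem bracket_zero : bracket 0 = 0 := by simp [bracket]

theorem bracket_add (m n : ℕ) : bracket (m + n) = bracket m + bracket n ^ 2 ^ m := by
  rw [bracket, bracket, bracket, sub_pow_char_pow, ← pow_mul, ← pow_add, add_comm n m]
  ring

theorem X_pow_injective : Function.Injective fun n : ℕ => (RatFunc.X : K) ^ n := by
  intro a b h
  have h' : algebraMap (ZMod 2)[X] K (X ^ a) = algebraMap (ZMod 2)[X] K (X ^ b) := by
    simpa using h
  simpa using congrArg natDegree (RatFunc.algebraMap_injective (ZMod 2) h')

theorem bracket_ne_zero {n : ℕ} (hn : n ≠ 0) : bracket n ≠ 0 := by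
  intro h
  have := X_pow_injective (a₁ := 2 ^ n) (a₂ := 1) (by simpa using sub_eq_zero.1 h)
  simp [hn] at this

theorem carlitzD_ne_zero (n : ℕ) : carlitzD n ≠ 0 := by
  refine prod_ne_zero_iff.2 fun j hj h => ?_
  have := Nat.pow_right_injective le_rfl (X_pow_injective (sub_eq_zero.1 h))
  exact (mem_range.1 hj).ne' this

theorem carlitzL_ne_zero (n : ℕ) : carlitzL n ≠ 0 :=
  prod_ne_zero_iff.2 fun _ hj => bracket_ne_zero (Nat.one_le_iff_ne_zero.1 (mem_Icc.1 hj).1)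

theorem carlitzD_zero : carlitzD 0 = 1 := by simp [carlitzD]

theorem carlitzL_zero : carlitzL 0 = 1 := by simp [carlitzL]

theorem carlitzD_succ (n : ℕ) : carlitzD (n + 1) = bracket (n + 1) * carlitzD n ^ 2 := by
  rw [carlitzD, prod_range_succ', mul_comm, carlitzD, ← prod_pow, bracket, pow_zero, pow_one]
  congr 1
  refine prod_congr rfl fun j _ => ?_
  rw [sub_pow_char, pow_succ 2 n, pow_succ 2 j, pow_mul, pow_mul]

theorem carlitzL_succ (n : ℕ) : carlitzL (n + 1) = bracket (n + 1) * carlitzL n := by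
  rw [carlitzL, ← insert_Icc_right_eq_Icc_add_one (by omega), prod_insert (by simp), carlitzL]

theorem carlitzD_one : carlitzD 1 = bracket 1 := by
  rw [carlitzD_succ, carlitzD_zero, one_pow, mul_one]

/-- Multiply by [n] = [n-k]^{2^k} + [k]. By D_{m+1} = [m+1] D_m^2 and L_{k+1} = [k+1] L_k, the two
resulting sums agree after a shift of k by one, so they cancel in characteristic 2. -/
theorem sum_carlitz_eq_zero {n : ℕ} (hn : n ≠ 0) :
    ∑ k ∈ range (n + 1), 1 / (carlitzD (n - k) ^ 2 ^ k * carlitzL k) = 0 := by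
  obtain ⟨n, rfl⟩ := Nat.exists_eq_succ_of_ne_zero hn
  refine (mul_eq_zero.1 ?_).resolve_left (bracket_ne_zero hn)
  have key : ∀ k ∈ range (n + 2),
      bracket (n + 1) * (1 / (carlitzD (n + 1 - k) ^ 2 ^ k * carlitzL k)) =
      bracket (n + 1 - k) ^ 2 ^ k / (carlitzD (n + 1 - k) ^ 2 ^ k * carlitzL k) +
        bracket k / (carlitzD (n + 1 - k) ^ 2 ^ k * carlitzL k) := fun k hk => by
    have : bracket (n + 1) = bracket k + bracket (n + 1 - k) ^ 2 ^ k := by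
      rw [← bracket_add, Nat.add_sub_cancel' (by have := mem_range.1 hk; omega)]
    rw [this]
    ring
  rw [Nat.succ_eq_add_one, mul_sum, sum_congr rfl key, sum_add_distrib, sum_range_succ,
    sum_range_succ' (fun k => bracket k / (carlitzD (n + 1 - k) ^ 2 ^ k * carlitzL k)),
    Nat.sub_self, bracket_zero, zero_pow (by positivity), zero_div, add_zero, zero_div, add_zero,
    ← sum_add_distrib]
  refine sum_eq_zero fun k hk => ?_
  have hD := carlitzD_ne_zero (n - k)
  have hL := carlitzL_ne_zero k
  have hb := bracket_ne_zero (Nat.succ_ne_zero k)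
  have hb' := bracket_ne_zero (Nat.succ_ne_zero (n - k))
  rw [Nat.add_sub_add_right, Nat.sub_add_comm (Nat.lt_succ_iff.1 (mem_range.1 hk)), carlitzD_succ,
    carlitzL_succ, mul_pow, ← pow_mul, ← pow_succ', mul_assoc,
    div_mul_eq_div_div, div_self (pow_ne_zero _ hb'), mul_left_comm, div_mul_eq_div_div (bracket _),
    div_self hb]
  exact CharTwo.add_self_eq_zero _

theorem one_div_carlitzL_succ (k : ℕ) :
    1 / carlitzL (k + 1) =
      ∑ j ∈ range (k + 1), (1 / carlitzD (k + 1 - j)) ^ 2 ^ j * (1 / carlitzL j) := by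
  have h := sum_carlitz_eq_zero (Nat.succ_ne_zero k)
  rw [Nat.succ_eq_add_one, sum_range_succ, Nat.sub_self, carlitzD_zero, one_pow, one_mul,
    CharTwo.add_eq_zero] at h
  rw [← h]
  refine sum_congr rfl fun j _ => ?_
  rw [div_pow, one_pow, div_mul_div_comm, one_mul]

theorem fSeq_eq_one_div_carlitzL {e : ℕ → K} (he : ∀ i, 1 ≤ i → e (2 ^ i - 1) = 1 / carlitzD i)
    (k : ℕ) : fSeq e k = 1 / carlitzL k := by
  refine (eq_fSeq (g := fun k => 1 / carlitzL k) (by simp [carlitzL_zero]) (fun k => ?_) k).symm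
  rw [one_div_carlitzL_succ]
  refine sum_congr rfl fun j hj => ?_
  rw [he _ (by have := mem_range.1 hj; omega)]

/-- The left side is the recursion for 1/L_n without its last term 1/([1]^{2^{n-1}} L_{n-1}). -/
theorem xFormula_carlitz {n : ℕ} (hn : 1 ≤ n) {e f : ℕ → K}
    (he : ∀ i, 1 ≤ i → e (2 ^ i - 1) = 1 / carlitzD i) (hf : ∀ i, f i = 1 / carlitzL i) :
    xFormula e f n = bracket (n - 1) / (carlitzL n * bracket 1 ^ 2 ^ (n - 1)) := by
  obtain ⟨n, rfl⟩ := Nat.exists_eq_add_of_le' hn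
  have h := one_div_carlitzL_succ n
  rw [sum_range_succ, Nat.add_sub_cancel_left, carlitzD_one] at h
  rw [xFormula, Nat.add_sub_cancel]
  have h2 : ∀ k ∈ range n, e (2 ^ (n + 1 - k) - 1) ^ 2 ^ k * f k =
      (1 / carlitzD (n + 1 - k)) ^ 2 ^ k * (1 / carlitzL k) := fun k hk => by
    rw [he _ (by have := mem_range.1 hk; omega), hf]
  rw [sum_congr rfl h2, ← sub_eq_of_eq_add h, carlitzL_succ, bracket_add n 1]
  have hL := carlitzL_ne_zero n
  have hb := bracket_ne_zero one_ne_zero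
  have hb' := bracket_ne_zero (Nat.succ_ne_zero n)
  rw [Nat.succ_eq_add_one, bracket_add n 1] at hb'
  rw [div_pow, one_pow]
  field_simp
  linear_combination -CharTwo.add_self_eq_zero (bracket n)

end Carlitz

/-! ### Inverse power sums over additive groups and their cosets -/

section PowerSums

variable {F : Type*} [Field F]

theorem inv_pow_sub {a : F} (ha : a ≠ 0) {N k : ℕ} (h : k ≤ N) :
    a⁻¹ ^ (N - k) = a⁻¹ ^ N * a ^ k := by
  rw [pow_sub₀ _ (inv_ne_zero ha) h, inv_pow a k, inv_inv]

/-- The relation only has to select one orientation of each pair; transitivity plays no role, so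
both `<` and `Precedes` qualify. -/
theorem sum_rel_add_swap {ι M : Type*} [DecidableEq ι] [AddCommMonoid M] (S : Finset ι)
    (r : ι → ι → Prop) [DecidableRel r]
    (hr : ∀ a ∈ S, ∀ b ∈ S, a ≠ b → (r a b ↔ ¬ r b a)) (hirr : ∀ a ∈ S, ¬ r a a) (u : ι → ι → M) :
    ∑ p ∈ S ×ˢ S with r p.1 p.2, (u p.1 p.2 + u p.2 p.1) = ∑ p ∈ S.offDiag, u p.1 p.2 := by
  have h1 : ∑ p ∈ S ×ˢ S with r p.1 p.2, u p.2 p.1 =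
      ∑ p ∈ S.offDiag with ¬ r p.1 p.2, u p.1 p.2 := by
    refine sum_bij' (fun p _ => p.swap) (fun p _ => p.swap) ?_ ?_ (by simp) (by simp) (by simp)
    · rintro ⟨a, b⟩ h
      simp only [mem_filter, mem_product, mem_offDiag, Prod.swap] at h ⊢
      have hab : b ≠ a := by
        rintro rfl
        exact hirr _ h.1.1 h.2
      exact ⟨⟨h.1.2, h.1.1, hab⟩, (hr a h.1.1 b h.1.2 hab.symm).1 h.2⟩
    · rintro ⟨a, b⟩ h
      simp only [mem_filter, mem_product, mem_offDiag, Prod.swap] at h ⊢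
      exact ⟨⟨h.1.2.1, h.1.1⟩, (hr b h.1.2.1 a h.1.1 (Ne.symm h.1.2.2)).2 h.2⟩
  have h2 : {p ∈ S ×ˢ S | r p.1 p.2} = {p ∈ S.offDiag | r p.1 p.2} := by
    ext ⟨a, b⟩
    simp only [mem_filter, mem_product, mem_offDiag]
    refine ⟨fun h => ⟨⟨h.1.1, h.1.2, ?_⟩, h.2⟩, fun h => ⟨⟨h.1.1, h.1.2.1⟩, h.2⟩⟩
    rintro rfl
    exact hirr _ h.1.1 h.2
  rw [sum_add_distrib, h1, h2, sum_filter_add_sum_filter_not]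

theorem sum_offDiag_eq_zero {ι : Type*} [DecidableEq ι] [CharP F 2] (S : Finset ι) (h : ι → ι → F)
    (hs : ∀ a ∈ S, ∀ b ∈ S, a ≠ b → h a b = h b a) : ∑ p ∈ S.offDiag, h p.1 p.2 = 0 := by
  refine sum_involution (fun p _ => p.swap) ?_ ?_ ?_ ?_
  · rintro ⟨a, b⟩ hp
    have hp := mem_offDiag.1 hp
    change h a b + h b a = 0
    rw [hs a hp.1 b hp.2.1 hp.2.2, CharTwo.add_self_eq_zero]
  · rintro ⟨a, b⟩ hp - heq
    exact (mem_offDiag.1 hp).2.2 (congrArg Prod.snd heq)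
  · rintro ⟨a, b⟩ hp
    simp only [mem_offDiag, Prod.swap] at hp ⊢
    exact ⟨hp.2.1, hp.1, hp.2.2.symm⟩
  · simp

variable [CharP F 2]

theorem inv_mul_pow_two_pow {a b : F} (ha : a ≠ 0) (hb : b ≠ 0) (hab : a + b ≠ 0) (n : ℕ) :
    (a⁻¹ * b⁻¹) ^ 2 ^ n = (a + b)⁻¹ ^ 2 ^ n * (a⁻¹ ^ 2 ^ n + b⁻¹ ^ 2 ^ n) := by
  rw [← add_pow_char_pow, ← mul_pow]
  congr 1
  field_simp
  ring

/-- Multiply `inv_mul_pow_two_pow` by ab, written as a(a+b) + a^2 in the term with a^{-2^n} and as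
b(a+b) + b^2 in the other. -/
theorem inv_mul_pow_two_pow_sub_one {a b : F} (ha : a ≠ 0) (hb : b ≠ 0) (hab : a + b ≠ 0) {n : ℕ}
    (hn : 1 ≤ n) :
    (a⁻¹ * b⁻¹) ^ (2 ^ n - 1) =
      ((a + b)⁻¹ ^ (2 ^ n - 1) * a⁻¹ ^ (2 ^ n - 1) + (a + b)⁻¹ ^ 2 ^ n * a⁻¹ ^ (2 ^ n - 2)) +
      ((b + a)⁻¹ ^ (2 ^ n - 1) * b⁻¹ ^ (2 ^ n - 1) + (b + a)⁻¹ ^ 2 ^ n * b⁻¹ ^ (2 ^ n - 2)) := by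
  have h1 : 1 ≤ 2 ^ n := Nat.one_le_two_pow
  have h2 : 2 ≤ 2 ^ n := Nat.le_self_pow (by omega) 2
  rw [add_comm b a, inv_pow_sub ha h1, inv_pow_sub hb h1, inv_pow_sub ha h2, inv_pow_sub hb h2,
    inv_pow_sub hab h1, mul_pow, inv_pow_sub ha h1, inv_pow_sub hb h1]
  have key := inv_mul_pow_two_pow ha hb hab n
  rw [mul_pow] at key
  linear_combination (a * b) * key - (a + b)⁻¹ ^ 2 ^ n * (a⁻¹ ^ 2 ^ n * a ^ 2 + b⁻¹ ^ 2 ^ n * b ^ 2) *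
    CharTwo.two_eq_zero (R := F)

variable [DecidableEq F]

/-- The power sum `∑ a⁻¹ ^ (2 ^ n - 1)` over the nonzero elements of a finite set. -/
def invPowSum (V : Finset F) (n : ℕ) : F :=
  ∑ a ∈ V.erase 0, a⁻¹ ^ (2 ^ n - 1)

theorem invPowSum_pow (V : Finset F) (n j : ℕ) :
    invPowSum V n ^ 2 ^ j = ∑ a ∈ V.erase 0, a⁻¹ ^ (2 ^ (n + j) - 2 ^ j) := by
  rw [invPowSum, sum_pow_char_pow]
  refine sum_congr rfl fun a _ => ?_
  rw [← pow_mul, Nat.sub_mul, one_mul, ← pow_add]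

theorem sum_add_offDiag {V B : Finset F} (h1 : ∀ b ∈ B, ∀ b' ∈ B, b + b' ∈ V)
    (h2 : ∀ v ∈ V, ∀ b ∈ B, v + b ∈ B) (f g : F → F) :
    ∑ p ∈ B.offDiag, f (p.1 + p.2) * g p.1 = (∑ v ∈ V.erase 0, f v) * ∑ b ∈ B, g b := by
  rw [sum_mul_sum, ← sum_product']
  refine sum_bij' (fun p _ => (p.1 + p.2, p.1)) (fun p _ => (p.2, p.1 + p.2)) ?_ ?_ ?_ ?_ ?_
  · rintro ⟨a, b⟩ h
    simp only [mem_offDiag, mem_product, mem_erase] at h ⊢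
    exact ⟨⟨fun h0 => h.2.2 (CharTwo.add_eq_zero.1 h0), h1 a h.1 b h.2.1⟩, h.1⟩
  · rintro ⟨a, b⟩ h
    simp only [mem_offDiag, mem_product, mem_erase] at h ⊢
    refine ⟨h.2, h2 a h.1.2 b h.2, fun h0 => h.1.1 ?_⟩
    simpa using h0
  · rintro ⟨a, b⟩ -
    simp [add_right_comm a b a, CharTwo.add_self_eq_zero]
  · rintro ⟨a, b⟩ -
    simp [add_left_comm b a b, CharTwo.add_self_eq_zero]
  · simp

/-- For a finite additive group `V` in characteristic two, the sum of `(ab)^{-(2^n-1)}` over the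
unordered pairs of distinct nonzero elements. -/
theorem sum_pairs_invPow {ι : Type*} [DecidableEq ι] (S : Finset ι) (x : ι → F)
    (hinj : Set.InjOn x S) (hx : ∀ i ∈ S, x i ≠ 0) (r : ι → ι → Prop) [DecidableRel r]
    (hr : ∀ a ∈ S, ∀ b ∈ S, a ≠ b → (r a b ↔ ¬ r b a)) (hirr : ∀ a ∈ S, ¬ r a a)
    {V : Finset F} (hVS : V.erase 0 = S.image x) (hV : ∀ a ∈ V, ∀ b ∈ V, a + b ∈ V)
    {n : ℕ} (hn : 1 ≤ n) :
    ∑ p ∈ S ×ˢ S with r p.1 p.2, ((x p.1)⁻¹ * (x p.2)⁻¹) ^ (2 ^ n - 1) =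
      invPowSum V n ^ 2 + invPowSum V (n - 1) ^ 2 * invPowSum V 1 ^ 2 ^ n := by
  set u : F → F → F := fun a b =>
    (a + b)⁻¹ ^ (2 ^ n - 1) * a⁻¹ ^ (2 ^ n - 1) + (a + b)⁻¹ ^ 2 ^ n * a⁻¹ ^ (2 ^ n - 2) with hu
  have e1 : ∑ p ∈ S ×ˢ S with r p.1 p.2, ((x p.1)⁻¹ * (x p.2)⁻¹) ^ (2 ^ n - 1) =
      ∑ p ∈ S ×ˢ S with r p.1 p.2, (u (x p.1) (x p.2) + u (x p.2) (x p.1)) := by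
    refine sum_congr rfl ?_
    rintro ⟨a, b⟩ h
    simp only [mem_filter, mem_product] at h
    refine inv_mul_pow_two_pow_sub_one (hx a h.1.1) (hx b h.1.2) (fun hs => ?_) hn
    have hab := hinj h.1.1 h.1.2 (CharTwo.add_eq_zero.1 hs)
    subst hab
    exact hirr a h.1.1 h.2
  have e2 : ∑ p ∈ S.offDiag, u (x p.1) (x p.2) = ∑ p ∈ (V.erase 0).offDiag, u p.1 p.2 := by
    rw [hVS]
    refine sum_bij (fun p _ => (x p.1, x p.2)) ?_ ?_ ?_ (fun _ _ => rfl)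
    · rintro ⟨a, b⟩ h
      simp only [mem_offDiag] at h ⊢
      exact ⟨mem_image_of_mem _ h.1, mem_image_of_mem _ h.2.1, fun he => h.2.2 (hinj h.1 h.2.1 he)⟩
    · rintro ⟨a, b⟩ h ⟨a', b'⟩ h' heq
      simp only [mem_offDiag, Prod.mk.injEq] at h h' heq ⊢
      exact ⟨hinj h.1 h'.1 heq.1, hinj h.2.1 h'.2.1 heq.2⟩
    · rintro ⟨a, b⟩ h
      simp only [mem_offDiag, mem_image] at h
      obtain ⟨⟨i, hi, rfl⟩, ⟨j, hj, rfl⟩, hij⟩ := h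
      exact ⟨(i, j), mem_offDiag.2 ⟨hi, hj, fun h => hij (congrArg x h)⟩, rfl⟩
  -- The substitution (a, b) ↦ (a+b, a) decouples the two factors, so that the sum becomes a
  -- difference of a product of power sums and a diagonal.
  have e3 : ∑ p ∈ (V.erase 0).offDiag, u p.1 p.2 = ∑ p ∈ (V.erase 0).offDiag,
      (p.1⁻¹ ^ (2 ^ n - 1) * p.2⁻¹ ^ (2 ^ n - 1) + p.1⁻¹ ^ 2 ^ n * p.2⁻¹ ^ (2 ^ n - 2)) := by
    refine sum_bij' (fun p _ => (p.1 + p.2, p.1)) (fun p _ => (p.2, p.1 + p.2)) ?_ ?_ ?_ ?_ ?_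
    · rintro ⟨a, b⟩ h
      simp only [mem_offDiag, mem_erase] at h ⊢
      refine ⟨⟨fun h0 => h.2.2 (CharTwo.add_eq_zero.1 h0), hV a h.1.2 b h.2.1.2⟩, h.1, fun h0 => ?_⟩
      exact h.2.1.1 (by simpa using h0)
    · rintro ⟨a, b⟩ h
      simp only [mem_offDiag, mem_erase] at h ⊢
      refine ⟨h.2.1, ⟨fun h0 => h.2.2 (CharTwo.add_eq_zero.1 h0), hV a h.1.2 b h.2.1.2⟩, fun h0 => ?_⟩
      exact h.1.1 (by simpa using h0)
    · rintro ⟨a, b⟩ -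
      simp [add_right_comm a b a, CharTwo.add_self_eq_zero]
    · rintro ⟨a, b⟩ -
      simp [add_left_comm b a b, CharTwo.add_self_eq_zero]
    · simp [hu]
  have h2 : 2 ≤ 2 ^ n := Nat.le_self_pow (by omega) 2
  have e4 := sum_product' (V.erase 0) (V.erase 0) fun a b =>
    a⁻¹ ^ (2 ^ n - 1) * b⁻¹ ^ (2 ^ n - 1) + a⁻¹ ^ 2 ^ n * b⁻¹ ^ (2 ^ n - 2)
  rw [← diag_union_offDiag, sum_union (disjoint_diag_offDiag _), sum_diag] at e4
  -- Both diagonal terms have exponent 2^{n+1} - 2, hence cancel.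
  have e5 : ∑ a ∈ V.erase 0,
      (a⁻¹ ^ (2 ^ n - 1) * a⁻¹ ^ (2 ^ n - 1) + a⁻¹ ^ 2 ^ n * a⁻¹ ^ (2 ^ n - 2)) = 0 := by
    refine sum_eq_zero fun a _ => ?_
    rw [← pow_add, ← pow_add, show 2 ^ n - 1 + (2 ^ n - 1) = 2 ^ n + (2 ^ n - 2) by omega]
    exact CharTwo.add_self_eq_zero _
  have p1 := invPowSum_pow V (n - 1) 1
  have p2 := invPowSum_pow V 1 n
  rw [Nat.sub_add_cancel hn, pow_one] at p1
  rw [add_comm, pow_succ 2 n, mul_two, Nat.add_sub_cancel] at p2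
  rw [e1, sum_rel_add_swap S r hr hirr fun i j => u (x i) (x j), e2, e3, p1, p2]
  rw [e5, zero_add] at e4
  rw [e4]
  simp_rw [sum_add_distrib, ← mul_sum, ← sum_mul]
  rw [sq, invPowSum]
  ring

/-- Expand the right side. The diagonal of B × B gives the left side. The off-diagonal part cancels
against the sum over V, reindexed by v = a + b with a, b in B: the combined summand is symmetric in
a and b, so it sums to zero over ordered pairs. -/
theorem sum_torsor_invPow {V B : Finset F} (h1 : ∀ b ∈ B, ∀ b' ∈ B, b + b' ∈ V)
    (h2 : ∀ v ∈ V, ∀ b ∈ B, v + b ∈ B) (hB : 0 ∉ B) (hVB : Disjoint V B) (k : ℕ) :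
    ∑ b ∈ B, b⁻¹ ^ (2 ^ (k + 1) - 1) = (∑ b ∈ B, b⁻¹) ^ 2 ^ k * invPowSum (V ∪ B) k := by
  have h0 : ∀ b ∈ B, b ≠ 0 := fun b hb h => hB (h ▸ hb)
  have hN : 1 ≤ 2 ^ k := Nat.one_le_two_pow
  have e1 : invPowSum (V ∪ B) k = invPowSum V k + ∑ b ∈ B, b⁻¹ ^ (2 ^ k - 1) := by
    rw [invPowSum, erase_union_distrib, erase_eq_of_notMem hB,
      sum_union (hVB.mono_left (erase_subset _ _)), invPowSum]
  have e2 := sum_product' B B fun a b => a⁻¹ ^ (2 ^ k - 1) * b⁻¹ ^ 2 ^ k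
  rw [← diag_union_offDiag, sum_union (disjoint_diag_offDiag _), sum_diag] at e2
  have e3 := sum_add_offDiag h1 h2 (fun v => v⁻¹ ^ (2 ^ k - 1)) (fun b => b⁻¹ ^ 2 ^ k)
  have e4 : ∑ p ∈ B.offDiag, (p.1⁻¹ ^ (2 ^ k - 1) * p.2⁻¹ ^ 2 ^ k +
      (p.1 + p.2)⁻¹ ^ (2 ^ k - 1) * p.1⁻¹ ^ 2 ^ k) = 0 := by
    have hc : ∀ p ∈ B.offDiag, p.1⁻¹ ^ (2 ^ k - 1) * p.2⁻¹ ^ 2 ^ k +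
      (p.1 + p.2)⁻¹ ^ (2 ^ k - 1) * p.1⁻¹ ^ 2 ^ k =
        (p.1⁻¹ ^ 2 ^ k * p.2⁻¹ ^ 2 ^ k * p.1 + (p.1 + p.2) * (p.1 + p.2)⁻¹ ^ 2 ^ k * p.1⁻¹ ^ 2 ^ k) := by
      rintro ⟨a, b⟩ h
      have h := mem_offDiag.1 h
      rw [inv_pow_sub (h0 a h.1) hN, inv_pow_sub (fun hs => h.2.2 (CharTwo.add_eq_zero.1 hs)) hN]
      ring
    rw [sum_congr rfl hc]
    refine sum_offDiag_eq_zero B (fun a b =>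
      a⁻¹ ^ 2 ^ k * b⁻¹ ^ 2 ^ k * a + (a + b) * (a + b)⁻¹ ^ 2 ^ k * a⁻¹ ^ 2 ^ k)
      fun a ha b hb hab => ?_
    have key := inv_mul_pow_two_pow (h0 a ha) (h0 b hb)
      (fun hs => hab (CharTwo.add_eq_zero.1 hs)) k
    rw [mul_pow] at key
    rw [add_comm b a]
    linear_combination (a - b) * key +
      (a + b)⁻¹ ^ 2 ^ k * (a * a⁻¹ ^ 2 ^ k - b * b⁻¹ ^ 2 ^ k) * CharTwo.two_eq_zero (R := F)
  rw [sum_add_distrib, e3, CharTwo.add_eq_zero] at e4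
  have e5 : ∀ b ∈ B, b⁻¹ ^ (2 ^ k - 1) * b⁻¹ ^ 2 ^ k = b⁻¹ ^ (2 ^ (k + 1) - 1) := fun b _ => by
    rw [← pow_add]
    congr 1
    rw [pow_succ]
    omega
  simp_rw [← mul_sum, ← sum_mul] at e2
  rw [sum_congr rfl e5, e4] at e2
  rw [e1, sum_pow_char_pow, invPowSum]
  have := CharTwo.add_self_eq_zero ((∑ v ∈ V.erase 0, v⁻¹ ^ (2 ^ k - 1)) * ∑ b ∈ B, b⁻¹ ^ 2 ^ k)
  linear_combination e2 - this

end PowerSums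

/-! ### Compositional inverses of additive series -/

section Inverse

variable {R : Type*} [CommRing R] [CharP R 2]

/-- Left and right inverses agree for composition of additive power series
`∑ a_i z ^ 2 ^ i` in characteristic two. -/
theorem left_inverse_eq_right_inverse {e f p : ℕ → R} (hf0 : f 0 = 1) (hp0 : p 0 = 1) (he0 : e 0 = 1)
    (hf : ∀ n, n ≠ 0 → ∑ q ∈ antidiagonal n, f q.1 * e q.2 ^ 2 ^ q.1 = 0)
    (hp : ∀ n, n ≠ 0 → ∑ q ∈ antidiagonal n, e q.1 * p q.2 ^ 2 ^ q.1 = 0) (n : ℕ) : f n = p n := by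
  have h1 : ∑ q ∈ antidiagonal n, f q.1 * (∑ s ∈ antidiagonal q.2, e s.1 * p s.2 ^ 2 ^ s.1) ^ 2 ^ q.1
      = f n := by
    rw [sum_eq_single (n, 0)]
    · simp [he0, hp0]
    · rintro ⟨a, b⟩ h hne
      rw [hp, zero_pow (by positivity), mul_zero]
      rintro rfl
      simp only [HasAntidiagonal.mem_antidiagonal, add_zero] at h
      exact hne (by rw [h])
    · simp
  have h2 : ∑ q ∈ antidiagonal n, (∑ s ∈ antidiagonal q.1, f s.1 * e s.2 ^ 2 ^ s.1) * p q.2 ^ 2 ^ q.1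
      = p n := by
    rw [sum_eq_single (0, n)]
    · simp [he0, hf0]
    · rintro ⟨a, b⟩ h hne
      rw [hf, zero_mul]
      rintro rfl
      simp only [HasAntidiagonal.mem_antidiagonal, zero_add] at h
      exact hne (by rw [h])
    · simp
  rw [← h1, ← h2]
  simp_rw [sum_pow_char_pow, mul_sum, sum_mul]
  -- Associativity: both sides are the sum of f_i e_j^{2^i} p_k^{2^{i+j}} over i + j + k = n.
  rw [sum_sigma', sum_sigma']
  refine sum_nbij' (fun ⟨⟨i, _⟩, ⟨j, k⟩⟩ => ⟨(i + j, k), (i, j)⟩)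
    (fun ⟨⟨_, k⟩, ⟨i, j⟩⟩ => ⟨(i, j + k), (j, k)⟩) ?_ ?_ ?_ ?_ ?_
  · rintro ⟨⟨i, l⟩, ⟨j, k⟩⟩ h
    simp only [mem_sigma, HasAntidiagonal.mem_antidiagonal] at h ⊢
    exact ⟨by omega, trivial⟩
  · rintro ⟨⟨l, k⟩, ⟨i, j⟩⟩ h
    simp only [mem_sigma, HasAntidiagonal.mem_antidiagonal] at h ⊢
    exact ⟨by omega, trivial⟩
  · rintro ⟨⟨i, l⟩, ⟨j, k⟩⟩ h
    simp only [mem_sigma, HasAntidiagonal.mem_antidiagonal] at h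
    obtain ⟨-, rfl⟩ := h
    rfl
  · rintro ⟨⟨l, k⟩, ⟨i, j⟩⟩ h
    simp only [mem_sigma, HasAntidiagonal.mem_antidiagonal] at h
    obtain ⟨-, rfl⟩ := h
    rfl
  · rintro ⟨⟨i, l⟩, ⟨j, k⟩⟩ -
    simp only [mul_pow, ← pow_mul, ← pow_add, add_comm j i]
    ring

end Inverse

/-! ### The universal expression of G_n in elementary symmetric functions -/

section Universal

/-- Only finitely many e_i occur, and in sufficiently many variables those are algebraically
independent. -/
theorem eq_zero_of_aeval_esymm {R : Type*} [CommRing R] [Nontrivial R] {Q : MvPolynomial ℕ+ R}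
    (h : ∀ N : ℕ, MvPolynomial.aeval (fun i : ℕ+ => MvPolynomial.esymm (Fin N) R (i : ℕ)) Q = 0) : Q = 0 := by
  obtain ⟨N, hN⟩ : ∃ N : ℕ, ∀ i ∈ Q.vars, (i : ℕ) ≤ N :=
    ⟨Q.vars.sup (fun i => (i : ℕ)), fun i hi => le_sup (f := fun i : ℕ+ => (i : ℕ)) hi⟩
  have hinj : Function.Injective (fun i : Fin N => Nat.succPNat i) := fun a b hab =>
    Fin.ext (Nat.succPNat_injective hab)
  obtain ⟨q, rfl⟩ := MvPolynomial.exists_rename_eq_of_vars_subset_range Q _ hinj fun i hi =>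
    ⟨⟨i - 1, by have := hN i hi; have := i.pos; omega⟩,
      PNat.eq (by have := i.pos; simp; omega)⟩
  have h1 := h N
  rw [MvPolynomial.aeval_rename] at h1
  have h2 : MvPolynomial.esymmAlgHom (Fin N) R N q = 0 := by
    refine Subtype.ext ?_
    rw [MvPolynomial.esymmAlgHom_apply]
    exact h1
  rw [(injective_iff_map_eq_zero _).1 (MvPolynomial.esymmAlgHom_fin_injective R le_rfl) q h2, map_zero]

theorem aeval_eVar {R : Type*} [CommRing R] (N i : ℕ) :
    MvPolynomial.aeval (fun i : ℕ+ => MvPolynomial.esymm (Fin N) R (i : ℕ)) (eVar R i) = MvPolynomial.esymm (Fin N) R i := by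
  rw [eVar]
  split_ifs with h
  · exact MvPolynomial.aeval_X _ _
  · rw [map_one, Nat.eq_zero_of_not_pos h, MvPolynomial.esymm_zero]

theorem exists_aeval_esymm_eq_psum {m : ℕ} (hm : 0 < m) :
    ∃ P : MvPolynomial ℕ+ ℤ, ∀ N : ℕ,
      MvPolynomial.aeval (fun i : ℕ+ => MvPolynomial.esymm (Fin N) ℤ (i : ℕ)) P = MvPolynomial.psum (Fin N) ℤ m := by
  induction m using Nat.strong_induction_on with
  | _ m ih =>
    choose! P hP using ih
    refine ⟨(-1) ^ (m + 1) * m * eVar ℤ m - ∑ a ∈ antidiagonal m with a.1 ∈ Set.Ioo 0 m,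
      (-1) ^ a.1 * eVar ℤ a.1 * P a.2, fun N => ?_⟩
    rw [MvPolynomial.psum_eq_mul_esymm_sub_sum _ _ _ hm]
    simp only [map_sub, map_mul, map_pow, map_neg, map_one, map_natCast, map_sum, aeval_eVar]
    congr 1
    refine sum_congr rfl fun a ha => ?_
    simp only [mem_filter, HasAntidiagonal.mem_antidiagonal, Set.mem_Ioo] at ha
    rw [hP _ (by omega) (by omega)]

theorem map_aeval_esymm {R : Type*} [CommRing R] (N : ℕ) (P : MvPolynomial ℕ+ ℤ) :
    MvPolynomial.aeval (fun i : ℕ+ => MvPolynomial.esymm (Fin N) R (i : ℕ)) (MvPolynomial.map (Int.castRingHom R) P) =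
      MvPolynomial.map (Int.castRingHom R) (MvPolynomial.aeval (fun i : ℕ+ => MvPolynomial.esymm (Fin N) ℤ (i : ℕ)) P) := by
  rw [MvPolynomial.map_aeval, MvPolynomial.aeval_def, MvPolynomial.eval₂_map, MvPolynomial.coe_eval₂Hom]
  congr 1
  · exact RingHom.ext_int _ _
  · simp_rw [MvPolynomial.map_esymm]

/-- Modulo 2, p_m^2 = p_{2m} by Frobenius. Algebraic independence over 𝔽₂ then makes all
coefficients of the integral expression for p_m^2 - p_{2m} even. -/
theorem exists_isElementaryExpression {m : ℕ} (hm : 0 < m) :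
    ∃ Q : MvPolynomial ℕ+ ℤ, IsElementaryExpression m Q := by
  obtain ⟨P, hP⟩ := exists_aeval_esymm_eq_psum hm
  obtain ⟨P', hP'⟩ := exists_aeval_esymm_eq_psum (m := 2 * m) (by omega)
  have h : MvPolynomial.map (Int.castRingHom (ZMod 2)) (P ^ 2 - P') = 0 := by
    refine eq_zero_of_aeval_esymm fun N => ?_
    rw [map_aeval_esymm, map_sub, map_pow, hP, hP', map_sub, map_pow]
    simp only [MvPolynomial.psum, map_sum, map_pow, MvPolynomial.map_X]
    rw [sum_pow_char]
    simp [← pow_mul, mul_comm]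
  obtain ⟨Q, hQ⟩ := (MvPolynomial.C_dvd_iff_zmod 2 _).2 h
  refine ⟨Q, fun N => ?_⟩
  rw [← hP, ← hP', ← map_pow, ← map_sub, hQ, map_mul, MvPolynomial.aeval_C]
  rfl

theorem IsElementaryExpression.unique {m : ℕ} {Q Q' : MvPolynomial ℕ+ ℤ}
    (hQ : IsElementaryExpression m Q) (hQ' : IsElementaryExpression m Q') : Q' = Q := by
  refine sub_eq_zero.1 (eq_zero_of_aeval_esymm fun N => ?_)
  have h := (hQ' N).trans (hQ N).symm
  rw [map_sub, sub_eq_zero]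
  exact mul_left_cancel₀ two_ne_zero h

theorem sq_sum_sub_sum_sq {R ι : Type*} [CommRing R] [Fintype ι] [LinearOrder ι] (y : ι → R) :
    (∑ i, y i) ^ 2 - ∑ i, y i ^ 2 = 2 * ∑ p ∈ univ ×ˢ univ with p.1 < p.2, y p.1 * y p.2 := by
  have h := sum_rel_add_swap (univ : Finset ι) (· < ·)
    (fun a _ b _ hab => by rw [not_lt, le_iff_lt_or_eq, or_iff_left hab])
    (fun a _ => lt_irrefl a) (fun a b => y a * y b)
  have h2 := sum_product' (univ : Finset ι) univ fun a b => y a * y b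
  rw [← diag_union_offDiag, sum_union (disjoint_diag_offDiag _), sum_diag] at h2
  rw [sq, sum_mul_sum, ← h2, ← h, mul_sum]
  simp_rw [sq, add_sub_cancel_left, two_mul]
  refine sum_congr rfl fun p _ => ?_
  rw [mul_comm (y p.2)]

/-- The division by 2 is carried out over ℤ, so the resulting pair sum can be evaluated in
characteristic 2. -/
theorem IsElementaryExpression.aeval_eq {m : ℕ} {Q : MvPolynomial ℕ+ ℤ}
    (hQ : IsElementaryExpression m Q) {F : Type*} [CommRing F] {N : ℕ} (x : Fin N → F) :
    MvPolynomial.aeval (fun i : ℕ+ => MvPolynomial.aeval x (MvPolynomial.esymm (Fin N) ℤ (i : ℕ))) Q =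
      ∑ p ∈ univ ×ˢ univ with p.1 < p.2, (x p.1 * x p.2) ^ m := by
  have h := hQ N
  have h2 := sq_sum_sub_sum_sq fun i : Fin N => (MvPolynomial.X i : MvPolynomial (Fin N) ℤ) ^ m
  simp_rw [← pow_mul, mul_comm m 2] at h2
  rw [MvPolynomial.psum, MvPolynomial.psum, h2] at h
  have h3 := congrArg (MvPolynomial.aeval x) (mul_left_cancel₀ two_ne_zero h)
  rw [MvPolynomial.comp_aeval_apply] at h3
  rw [h3]
  simp [mul_pow]

theorem aeval_mersennePart {R A : Type*} [CommRing R] [CommRing A] [Algebra R A] (v v' : ℕ+ → A)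
    (h : ∀ k (i : ℕ+), (i : ℕ) = 2 ^ k - 1 → v' i = v i)
    (h' : ∀ i : ℕ+, (¬ ∃ k : ℕ, (i : ℕ) = 2 ^ k - 1) → v' i = 0) (Q : MvPolynomial ℕ+ R) :
    MvPolynomial.aeval v (mersennePart Q) = MvPolynomial.aeval v' Q := by
  classical
  rw [mersennePart, map_sum, MvPolynomial.aeval_def (S₁ := A) v', MvPolynomial.eval₂_eq, sum_filter]
  refine sum_congr rfl fun s _ => ?_
  split_ifs with hs
  · rw [MvPolynomial.aeval_monomial, Finsupp.prod]
    congr 1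
    refine prod_congr rfl fun i hi => ?_
    obtain ⟨k, hk⟩ := hs i hi
    rw [h k i hk]
  · push Not at hs
    obtain ⟨i, hi, hk⟩ := hs
    rw [prod_eq_zero hi, mul_zero]
    rw [h' i (by simpa using hk), zero_pow (Finsupp.mem_support_iff.1 hi)]

end Universal

/-! ### Points with Mersenne support, and the proof of part (I) -/

section Points

variable {F : Type*} [Field F] [CharP F 2]

theorem cast_two_pow {k : ℕ} (hk : k ≠ 0) : ((2 ^ k : ℕ) : F) = 0 := by
  rw [Nat.cast_pow, Nat.cast_ofNat, CharTwo.two_eq_zero, zero_pow hk]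

theorem cast_two_pow_sub_one {k : ℕ} (hk : k ≠ 0) : ((2 ^ k - 1 : ℕ) : F) = 1 := by
  have h : ((2 ^ k - 1 : ℕ) : F) + (1 : ℕ) = 0 := by
    rw [← Nat.cast_add, Nat.sub_add_cancel Nat.one_le_two_pow, cast_two_pow hk]
  simpa using CharTwo.add_eq_zero.1 h

theorem mersenne_cast_mul {c : ℕ → F} (hc : ∀ i, (¬ ∃ k : ℕ, i = 2 ^ k - 1) → c i = 0) {i : ℕ}
    (hi : i ≠ 0) : c i * (i + 1 : ℕ) = 0 := by
  by_cases h : ∃ k : ℕ, i = 2 ^ k - 1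
  · obtain ⟨k, rfl⟩ := h
    have hk : k ≠ 0 := by
      rintro rfl
      exact hi rfl
    rw [Nat.sub_add_cancel Nat.one_le_two_pow, cast_two_pow hk, mul_zero]
  · rw [hc i h, zero_mul]

/-- Over an algebraically closed field of characteristic two, a sequence supported on the Mersenne
numbers is the sequence of elementary symmetric functions of the inverses of the nonzero elements
of a finite additive group. -/
theorem exists_additive_roots [IsAlgClosed F] [DecidableEq F] {d : ℕ} (hd : d ≠ 0) {c : ℕ → F}
    (c0 : c 0 = 1) (cN : c (2 ^ d - 1) ≠ 0) (hc : ∀ i, (¬ ∃ k : ℕ, i = 2 ^ k - 1) → c i = 0)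
    (hbig : ∀ i, 2 ^ d - 1 < i → c i = 0) :
    ∃ x : Fin (2 ^ d - 1) → F, Function.Injective x ∧ (∀ i, x i ≠ 0) ∧
      (∀ i, MvPolynomial.aeval x (MvPolynomial.esymm (Fin (2 ^ d - 1)) ℤ i) = c i) ∧
      ∀ y ∈ insert 0 (univ.image fun i => (x i)⁻¹), ∀ z ∈ insert 0 (univ.image fun i => (x i)⁻¹),
        y + z ∈ insert 0 (univ.image fun i => (x i)⁻¹) := by
  set N := 2 ^ d - 1 with hN
  have hNd : N + 1 = 2 ^ d := Nat.sub_add_cancel Nat.one_le_two_pow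
  set g : F[X] := ∑ i ∈ range (N + 1), C (c i) * X ^ (N - i) with hg
  have hcoeff : ∀ i ≤ N, g.coeff (N - i) = c i := fun i hi => by
    rw [hg, finsetSum_coeff, sum_eq_single i]
    · simp
    · intro j hj hji
      have := mem_range.1 hj
      rw [coeff_C_mul_X_pow, if_neg (by omega)]
    · intro h
      exact absurd (mem_range.2 (by omega)) h
  have hdeg : g.natDegree ≤ N := natDegree_sum_le_of_forall_le _ _ fun i _ =>
    (natDegree_C_mul_X_pow_le _ _).trans (Nat.sub_le _ _)
  have hlead : g.coeff N = 1 := by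
    have := hcoeff 0 (Nat.zero_le _)
    rwa [Nat.sub_zero, c0] at this
  have hmonic : g.Monic := monic_of_natDegree_le_of_coeff_eq_one N hdeg hlead
  have hnat : g.natDegree = N := le_antisymm hdeg
    (le_natDegree_of_ne_zero (by rw [hlead]; exact one_ne_zero))
  have hcard : g.roots.card = N := by
    rw [← hnat, ← splits_iff_card_roots]
    exact IsAlgClosed.splits g
  have heval : ∀ x, g.eval x = ∑ i ∈ range (N + 1), c i * x ^ (N - i) := fun x => by
    simp [hg, eval_finsetSum]
  have hne : ∀ x, g.IsRoot x → x ≠ 0 := by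
    rintro x hx rfl
    apply cN
    have h := hcoeff N le_rfl
    rwa [Nat.sub_self, coeff_zero_eq_eval_zero, show g.eval 0 = 0 from hx, eq_comm] at h
  -- For i = 2^k - 1 with k ≥ 1, N - i is even, so only the leading term survives differentiation.
  -- As 0 is not a root, all roots are simple.
  have hder : ∀ x, g.derivative.eval x = x ^ (N - 1) := fun x => by
    rw [hg, derivative_sum, eval_finsetSum, sum_eq_single 0]
    · rw [Nat.sub_zero, c0, derivative_C_mul_X_pow, cast_two_pow_sub_one hd]
      simp
    · intro i hi h0
      have h := mersenne_cast_mul hc h0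
      have hi := mem_range.1 hi
      have h3 : ((N - i : ℕ) : F) = (i + 1 : ℕ) := by
        have h2 : ((N - i : ℕ) : F) + (i + 1 : ℕ) = 0 := by
          rw [← Nat.cast_add, show N - i + (i + 1) = 2 ^ d by omega, cast_two_pow hd]
        exact CharTwo.add_eq_zero.1 h2
      rw [derivative_C_mul_X_pow, h3, h]
      simp
    · simp
  have hnodup : g.roots.Nodup := by
    refine Multiset.nodup_iff_count_le_one.2 fun x => ?_
    rw [count_roots, ← not_lt, one_lt_rootMultiplicity_iff_isRoot hmonic.ne_zero]
    rintro ⟨h1, h2⟩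
    rw [IsRoot, hder] at h2
    exact hne x h1 (eq_zero_of_pow_eq_zero h2)
  obtain ⟨x, hx⟩ : ∃ x : Fin N → F, univ.val.map x = g.roots := by
    have hl : g.roots.toList.length = N := by rw [Multiset.length_toList, hcard]
    refine ⟨fun i => g.roots.toList.get (i.cast hl.symm), ?_⟩
    rw [Fin.univ_val_map]
    refine (congrArg _ ?_).trans (Multiset.coe_toList g.roots)
    refine List.ext_get (by simp [hcard]) fun i h1 h2 => ?_
    simp
  have hroot : ∀ y, g.IsRoot y ↔ ∃ i, x i = y := fun y => by
    rw [← mem_roots hmonic.ne_zero, ← hx]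
    simp
  have hx0 : ∀ i, x i ≠ 0 := fun i => hne _ ((hroot _).2 ⟨i, rfl⟩)
  have hmem : ∀ y, y ∈ insert 0 (univ.image fun i => (x i)⁻¹) ↔
      ∑ i ∈ range (N + 1), c i * y ^ (i + 1) = 0 := fun y => by
    by_cases hy : y = 0
    · simp [hy]
    · have h1 : ∑ i ∈ range (N + 1), c i * y ^ (i + 1) = y ^ (N + 1) * g.eval y⁻¹ := by
        rw [heval, mul_sum]
        refine sum_congr rfl fun i hi => ?_
        rw [inv_pow_sub hy (by have := mem_range.1 hi; omega), inv_pow]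
        field_simp
        ring
      rw [h1, mul_eq_zero, or_iff_right (pow_ne_zero _ hy), ← IsRoot, hroot]
      simp [hy, inv_eq_iff_eq_inv]
  refine ⟨x, ?_, hx0, fun i => ?_, fun y hy z hz => ?_⟩
  · rw [← hx] at hnodup
    exact fun i j h => Multiset.inj_on_of_nodup_map hnodup i (mem_univ_val i) j (mem_univ_val j) h
  · rw [MvPolynomial.aeval_esymm_eq_multiset_esymm, hx]
    rcases le_or_gt i N with hi | hi
    · have h := coeff_eq_esymm_roots_of_card (hcard.trans hnat.symm)
        (k := N - i) (by rw [hnat]; exact Nat.sub_le _ _)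
      rw [hcoeff i hi, hnat, hmonic.leadingCoeff, CharTwo.neg_eq, one_pow, one_mul, one_mul,
        Nat.sub_sub_self hi] at h
      exact h.symm
    · rw [hbig i hi, Multiset.esymm, Multiset.powersetCard_eq_empty _ (by rwa [hcard])]
      simp
  · rw [hmem] at hy hz ⊢
    have : ∀ i ∈ range (N + 1), c i * (y + z) ^ (i + 1) = c i * y ^ (i + 1) + c i * z ^ (i + 1) := by
      intro i _
      by_cases h : ∃ k : ℕ, i = 2 ^ k - 1
      · obtain ⟨k, rfl⟩ := h
        rw [Nat.sub_add_cancel Nat.one_le_two_pow, add_pow_char_pow, mul_add]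
      · rw [hc i h]
        ring
    rw [sum_congr rfl this, sum_add_distrib, hy, hz, add_zero]

/-- Newton's identities for elementary symmetric functions supported on the Mersenne numbers. -/
theorem sum_psum_mersenne {N : ℕ} {c : ℕ → F} (hc : ∀ i, (¬ ∃ k : ℕ, i = 2 ^ k - 1) → c i = 0)
    {x : Fin N → F}
    (hx : ∀ i, MvPolynomial.aeval x (MvPolynomial.esymm (Fin N) ℤ i) = c i) {n : ℕ} (hn : n ≠ 0) :
    c (2 ^ n - 1) + ∑ j ∈ range n, c (2 ^ j - 1) * (∑ i, x i ^ (2 ^ (n - j) - 1)) ^ 2 ^ j = 0 := by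
  have hsgn : ∀ k, (-1 : F) ^ k = 1 := fun k => by rw [CharTwo.neg_eq, one_pow]
  have h := congrArg (MvPolynomial.aeval x) (MvPolynomial.mul_esymm_eq_sum (Fin N) ℤ (2 ^ n - 1))
  have h2 : ((2 ^ n - 1 : ℕ) : F) = 1 := cast_two_pow_sub_one hn
  simp only [map_mul, map_natCast, map_pow, map_neg, map_one, map_sum, hsgn, hx, one_mul, h2,
    MvPolynomial.psum, MvPolynomial.aeval_X] at h
  rw [h, CharTwo.add_eq_zero, sum_filter, Nat.sum_antidiagonal_eq_sum_range_succ_mk]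
  symm
  have hinj : Set.InjOn (fun j => 2 ^ j - 1) (range n : Set ℕ) := fun a _ b _ hab => by
    have h1 : 1 ≤ 2 ^ a := Nat.one_le_two_pow
    have h2 : 1 ≤ 2 ^ b := Nat.one_le_two_pow
    exact Nat.pow_right_injective le_rfl (by simp only at hab ⊢; omega)
  -- Only the indices 2^j - 1 contribute to Newton's identity, and there the power sum has index 2^n
  -- - 2^j, so it is a 2^j-th power.
  refine Eq.trans ?_ (sum_subset (s₁ := (range n).image fun j => 2 ^ j - 1) ?_ ?_)
  · rw [sum_image hinj]
    refine sum_congr rfl fun j hj => ?_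
    have hj := mem_range.1 hj
    have h1 : 1 ≤ 2 ^ j := Nat.one_le_two_pow
    have h3 : 2 ^ j < 2 ^ n := Nat.pow_lt_pow_right (by norm_num) hj
    rw [if_pos (by omega), sum_pow_char_pow]
    congr 1
    refine sum_congr rfl fun i _ => ?_
    rw [← pow_mul, Nat.sub_mul, one_mul, ← pow_add, Nat.sub_add_cancel hj.le]
    congr 1
    omega
  · intro i hi
    obtain ⟨j, hj, rfl⟩ := mem_image.1 hi
    have h3 : 2 ^ j < 2 ^ n := Nat.pow_lt_pow_right (by norm_num) (mem_range.1 hj)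
    exact mem_range.2 (by omega)
  · intro i hi hi'
    split_ifs with h4
    · rw [hc i, zero_mul]
      rintro ⟨j, rfl⟩
      refine hi' (mem_image_of_mem _ (mem_range.2 ?_))
      have h1 : 1 ≤ 2 ^ j := Nat.one_le_two_pow
      exact (Nat.pow_lt_pow_iff_right (by norm_num)).1 (show 2 ^ j < 2 ^ n by omega)
    · rfl

theorem sum_antidiagonal_fSeq (c : ℕ → F) (c0 : c 0 = 1) {n : ℕ} (hn : n ≠ 0) :
    ∑ q ∈ antidiagonal n, fSeq c q.1 * c (2 ^ q.2 - 1) ^ 2 ^ q.1 = 0 := by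
  obtain ⟨n, rfl⟩ := Nat.exists_eq_succ_of_ne_zero hn
  rw [Nat.sum_antidiagonal_eq_sum_range_succ_mk, sum_range_succ, Nat.succ_eq_add_one,
    fSeq_succ_eq_sum, Nat.sub_self, pow_zero, Nat.sub_self, c0, one_pow, mul_one,
    CharTwo.add_eq_zero]
  exact sum_congr rfl fun _ _ => mul_comm _ _

theorem xSeq_eq_fSeq_add (c : ℕ → F) {n : ℕ} (hn : 1 ≤ n) :
    xSeq c n = fSeq c n + fSeq c (n - 1) * c 1 ^ 2 ^ (n - 1) := by
  obtain ⟨n, rfl⟩ := Nat.exists_eq_add_of_le' hn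
  rw [fSeq_succ, Nat.add_sub_cancel]
  linear_combination -(fSeq c n * c 1 ^ 2 ^ n) * CharTwo.two_eq_zero (R := F)

/-- Newton's identities turn the power sums of the group of roots into f_k; the pair-sum formula is
then the Frobenius square of f_n + f_{n-1} c_1^{2^{n-1}}. -/
theorem IsElementaryExpression.aeval_mersenne [IsAlgClosed F] {n : ℕ} (hn : 1 ≤ n)
    {Q : MvPolynomial ℕ+ ℤ} (hQ : IsElementaryExpression (2 ^ n - 1) Q)
    {d : ℕ} (hd : d ≠ 0) {c : ℕ → F}
    (c0 : c 0 = 1) (cN : c (2 ^ d - 1) ≠ 0) (hc : ∀ i, (¬ ∃ k : ℕ, i = 2 ^ k - 1) → c i = 0)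
    (hbig : ∀ i, 2 ^ d - 1 < i → c i = 0) :
    MvPolynomial.aeval (fun i : ℕ+ => c i) Q = xSeq c n ^ 2 := by
  classical
  obtain ⟨x, hinj, hx0, hx, hV⟩ := exists_additive_roots hd c0 cN hc hbig
  have hP : ∀ k, fSeq c k = ∑ i, x i ^ (2 ^ k - 1) := by
    refine left_inverse_eq_right_inverse (e := fun k => c (2 ^ k - 1)) (fSeq_zero c) ?_ c0
      (fun n hn => sum_antidiagonal_fSeq c c0 hn) (fun n hn => ?_)
    · have h2 : ((2 ^ d - 1 : ℕ) : F) = 1 := cast_two_pow_sub_one hd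
      simpa using h2
    · rw [Nat.sum_antidiagonal_eq_sum_range_succ_mk, sum_range_succ, add_comm]
      convert sum_psum_mersenne hc hx hn using 2
      have h2 : ((2 ^ d - 1 : ℕ) : F) = 1 := cast_two_pow_sub_one hd
      simp [h2]
  have h0 : (0 : F) ∉ univ.image fun i => (x i)⁻¹ := by
    simp [hx0]
  have hinj' : Function.Injective fun i => (x i)⁻¹ := inv_injective.comp hinj
  have hpow : ∀ k, invPowSum (insert 0 (univ.image fun i => (x i)⁻¹)) k = fSeq c k := fun k => by
    rw [invPowSum, erase_insert h0, sum_image hinj'.injOn, hP]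
    simp
  have h := sum_pairs_invPow univ (fun i => (x i)⁻¹) hinj'.injOn (fun i _ => inv_ne_zero (hx0 i))
    (· < ·) (fun a _ b _ hab => by rw [not_lt, le_iff_lt_or_eq, or_iff_left hab])
    (fun a _ => lt_irrefl a) (erase_insert h0) hV hn
  simp only [inv_inv, hpow] at h
  have h1 : fSeq c 1 = c 1 := by simp [fSeq_succ_eq_sum c 0, fSeq_zero]
  simp_rw [← hx]
  rw [hQ.aeval_eq, h, xSeq_eq_fSeq_add c hn, add_pow_char, mul_pow, h1, ← pow_mul (c 1),
    ← pow_succ, Nat.sub_add_cancel hn]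

theorem mersennePart_eq {n : ℕ} (hn : 1 ≤ n) {Q : MvPolynomial ℕ+ ℤ}
    (hQ : IsElementaryExpression (2 ^ n - 1) Q) :
    mersennePart (MvPolynomial.map (Int.castRingHom (ZMod 2)) Q) = xSeq (eVar (ZMod 2)) n ^ 2 := by
  classical
  -- An infinite field is needed to test polynomial identities at points, an algebraically closed
  -- one to have the roots.
  let Ω := AlgebraicClosure (ZMod 2)
  have : CharP Ω 2 := charP_of_injective_algebraMap (algebraMap (ZMod 2) Ω).injective 2
  set Q' := MvPolynomial.map (Int.castRingHom (ZMod 2)) Q with hQ'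
  refine MvPolynomial.map_injective _ (algebraMap (ZMod 2) Ω).injective
    (MvPolynomial.funext fun v => ?_)
  rw [MvPolynomial.eval_map, MvPolynomial.eval_map, ← MvPolynomial.aeval_def,
    ← MvPolynomial.aeval_def, map_pow]
  -- Neither Q nor X_n involves e_{2^d-1}, so that value may be set to 1, which keeps 0 from being a
  -- root of the reversed polynomial.
  obtain ⟨d, hd, hvars⟩ : ∃ d : ℕ, n < d ∧ ∀ i ∈ Q.vars, (i : ℕ) < 2 ^ d - 1 := by
    refine ⟨n + Q.vars.sup (fun i => (i : ℕ)) + 2, by omega, fun i hi => ?_⟩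
    have h1 : (i : ℕ) ≤ Q.vars.sup (fun i => (i : ℕ)) := le_sup (f := fun i : ℕ+ => (i : ℕ)) hi
    have h2 := Nat.lt_two_pow_self (n := n + Q.vars.sup (fun i => (i : ℕ)) + 1)
    rw [pow_succ]
    omega
  set c : ℕ → Ω := fun i => if h : 0 < i then
      if i = 2 ^ d - 1 then 1
      else if i < 2 ^ d - 1 ∧ ∃ k : ℕ, i = 2 ^ k - 1 then v ⟨i, h⟩ else 0
    else 1 with hcdef
  have hd0 : d ≠ 0 := by omega
  have hd1 : 0 < 2 ^ d - 1 := Nat.sub_pos_of_lt (Nat.one_lt_two_pow hd0)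
  have hcs : ∀ i, (¬ ∃ k : ℕ, i = 2 ^ k - 1) → c i = 0 := fun i hi => by
    have h0 : 0 < i := Nat.pos_of_ne_zero fun h => hi ⟨0, h⟩
    simp only [hcdef, dif_pos h0]
    rw [if_neg fun h => hi ⟨d, h⟩, if_neg fun h => hi h.2]
  have key := hQ.aeval_mersenne hn (c := c) hd0 (by simp [hcdef]) (by simp [hcdef, hd1]) hcs
    (fun i hi => by
      have h0 : 0 < i := by omega
      simp only [hcdef, dif_pos h0]
      rw [if_neg (by omega), if_neg (by omega)])
  have e1 : xSeq c n = MvPolynomial.aeval v (xSeq (eVar (ZMod 2)) n) := by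
    rw [← RingHom.coe_coe, map_xSeq]
    refine xSeq_congr fun i h1 hi => ?_
    have h2 : 1 < 2 ^ i := Nat.one_lt_two_pow (by omega)
    have h3 : 2 ^ i < 2 ^ d := Nat.pow_lt_pow_right (by norm_num) (by omega)
    have h0 : 0 < 2 ^ i - 1 := by omega
    simp only [hcdef, dif_pos h0, eVar]
    rw [if_neg (by omega), if_pos ⟨by omega, i, rfl⟩]
    exact (MvPolynomial.aeval_X _ _).symm
  rw [← e1, ← key, aeval_mersennePart v
    (fun i => if ∃ k : ℕ, (i : ℕ) = 2 ^ k - 1 then v i else 0)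
    (fun k i h => if_pos ⟨k, h⟩) (fun i h => if_neg h), hQ', MvPolynomial.aeval_def,
    MvPolynomial.eval₂_map, MvPolynomial.aeval_def, ← MvPolynomial.coe_eval₂Hom,
    ← MvPolynomial.coe_eval₂Hom]
  refine MvPolynomial.eval₂Hom_congr' (RingHom.ext_int _ _) (fun i hi _ => ?_) rfl
  have h1 := hvars i hi
  have h2 : c i = if (i : ℕ) < 2 ^ d - 1 ∧ ∃ k : ℕ, (i : ℕ) = 2 ^ k - 1 then v i else 0 := by
    simp only [hcdef, dif_pos i.pos]
    rw [if_neg h1.ne]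
    rfl
  rw [h2]
  exact if_congr (by simp [h1]) rfl rfl

end Points

/-! ### Power sums over polynomials of bounded degree -/

section Carlitz

open Classical in
/-- The set of polynomials in `t` of degree less than `d`. -/
noncomputable def polyLT : ℕ → Finset K
  | 0 => {0}
  | d + 1 => polyLT d ∪ (polyLT d).image fun v => v + RatFunc.X ^ d

/-- Carlitz's additive polynomial with set of roots `polyLT d`. -/
noncomputable def carlitzE : ℕ → K → K
  | 0, z => z
  | d + 1, z => carlitzE d z ^ 2 + carlitzD d * carlitzE d z

theorem carlitzE_add (d : ℕ) (y z : K) : carlitzE d (y + z) = carlitzE d y + carlitzE d z := by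
  induction d with
  | zero => rfl
  | succ d ih =>
    rw [carlitzE, carlitzE, carlitzE, ih, add_pow_char]
    ring

theorem carlitzE_X_mul (d : ℕ) (z : K) :
    carlitzE (d + 1) (RatFunc.X * z) =
      RatFunc.X * carlitzE (d + 1) z + bracket (d + 1) * carlitzE d z ^ 2 := by
  induction d with
  | zero =>
    simp only [carlitzE, carlitzD_zero, bracket]
    ring
  | succ d ih =>
    have e : ∀ k w, carlitzE (k + 1) w = carlitzE k w ^ 2 + carlitzD k * carlitzE k w :=
      fun _ _ => rfl
    rw [e (d + 1), ih, e (d + 1), e d, add_comm (d + 1) 1, bracket_add 1 (d + 1), carlitzD_succ,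
      pow_one, show bracket 1 = RatFunc.X ^ 2 - RatFunc.X from rfl]
    linear_combination (RatFunc.X * (carlitzE d z ^ 2 + carlitzD d * carlitzE d z) *
      bracket (d + 1) * carlitzE d z ^ 2 - bracket (d + 1) ^ 2 * carlitzD d * carlitzE d z ^ 3) *
      CharTwo.two_eq_zero (R := K)

/-- In `carlitzE_X_mul` at z = t^d the first term vanishes, since E_{d+1}(t^d) = D_d^2 + D_d^2 = 0.
-/
theorem carlitzE_X_pow (d : ℕ) : carlitzE d (RatFunc.X ^ d) = carlitzD d := by
  induction d with
  | zero => simp [carlitzE, carlitzD_zero]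
  | succ d ih =>
    rw [pow_succ', carlitzE_X_mul, carlitzE, ih, carlitzD_succ, ← sq, CharTwo.add_self_eq_zero,
      mul_zero, zero_add]

open Classical in
theorem carlitzE_eq_zero {d : ℕ} {v : K} (hv : v ∈ polyLT d) : carlitzE d v = 0 := by
  induction d generalizing v with
  | zero => simpa [polyLT, carlitzE] using hv
  | succ d ih =>
    rw [polyLT, mem_union, mem_image] at hv
    rcases hv with hv | ⟨a, ha, rfl⟩
    · simp [carlitzE, ih hv]
    · rw [carlitzE, carlitzE_add, ih ha, zero_add, carlitzE_X_pow, ← sq, CharTwo.add_self_eq_zero]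

open Classical in
theorem zero_mem_polyLT (d : ℕ) : 0 ∈ polyLT d := by
  induction d with
  | zero => simp [polyLT]
  | succ d ih => exact mem_union_left _ ih

open Classical in
theorem add_mem_polyLT {d : ℕ} {v w : K} (hv : v ∈ polyLT d) (hw : w ∈ polyLT d) :
    v + w ∈ polyLT d := by
  induction d generalizing v w with
  | zero =>
    simp only [polyLT, mem_singleton] at *
    simp [hv, hw]
  | succ d ih =>
    simp only [polyLT, mem_union, mem_image] at *
    rcases hv with hv | ⟨a, ha, rfl⟩ <;> rcases hw with hw | ⟨b, hb, rfl⟩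
    · exact Or.inl (ih hv hw)
    · exact Or.inr ⟨_, ih hv hb, by ring⟩
    · exact Or.inr ⟨_, ih ha hw, by ring⟩
    · refine Or.inl ?_
      have : a + RatFunc.X ^ d + (b + RatFunc.X ^ d) = a + b := by
        linear_combination RatFunc.X ^ d * CharTwo.two_eq_zero (R := K)
      rw [this]
      exact ih ha hb

open Classical in
theorem disjoint_polyLT (d : ℕ) :
    Disjoint (polyLT d) ((polyLT d).image fun v => v + RatFunc.X ^ d) := by
  refine disjoint_left.2 fun v hv hv' => ?_
  obtain ⟨a, ha, rfl⟩ := mem_image.1 hv'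
  have h := carlitzE_eq_zero hv
  rw [carlitzE_add, carlitzE_eq_zero ha, zero_add, carlitzE_X_pow] at h
  exact carlitzD_ne_zero d h

/-- This is the logarithmic derivative of E_d, whose linear coefficient is D_d / L_d. The induction
splits `polyLT (d + 1)` into two cosets. -/
theorem sum_polyLT_inv (d : ℕ) {w : K} (hw : carlitzE d w ≠ 0) :
    ∑ a ∈ polyLT d, (a + w)⁻¹ = carlitzD d / (carlitzL d * carlitzE d w) := by
  classical
  induction d generalizing w with
  | zero => simp [polyLT, carlitzE, carlitzD_zero, carlitzL_zero]
  | succ d ih =>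
    have hw' : carlitzE d w * (carlitzE d w + carlitzD d) ≠ 0 := by
      rw [carlitzE] at hw
      convert hw using 1
      ring
    obtain ⟨h1, h2⟩ := mul_ne_zero_iff.1 hw'
    have h3 : carlitzE d (RatFunc.X ^ d + w) ≠ 0 := by
      rwa [carlitzE_add, carlitzE_X_pow, add_comm]
    rw [polyLT, sum_union (disjoint_polyLT d), sum_image (add_left_injective _).injOn, ih h1]
    simp_rw [add_assoc]
    rw [ih h3, carlitzD_succ, carlitzL_succ, carlitzE, carlitzE_add, carlitzE_X_pow]
    have hb := bracket_ne_zero (Nat.succ_ne_zero d)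
    rw [Nat.succ_eq_add_one] at hb
    have hL := carlitzL_ne_zero d
    rw [add_comm (carlitzD d)]
    have h4 : carlitzE d w ^ 2 + carlitzD d * carlitzE d w ≠ 0 := hw
    rw [show carlitzE d w ^ 2 + carlitzD d * carlitzE d w =
      carlitzE d w * (carlitzE d w + carlitzD d) by ring]
    field_simp
    linear_combination carlitzD d * carlitzE d w * CharTwo.two_eq_zero (R := K)

theorem sum_monic_inv (d : ℕ) : ∑ a ∈ polyLT d, (a + RatFunc.X ^ d)⁻¹ = 1 / carlitzL d := by
  have h := carlitzD_ne_zero d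
  rw [sum_polyLT_inv d (by rwa [carlitzE_X_pow]), carlitzE_X_pow]
  field_simp

open Classical in
-- The monic polynomials of degree d are a coset of `polyLT d` whose inverses sum to 1/L_d, so
-- `sum_torsor_invPow` applies.
theorem invPowSum_polyLT_succ (d n : ℕ) :
    invPowSum (polyLT (d + 1)) (n + 1) = invPowSum (polyLT d) (n + 1) +
      (1 / carlitzL d) ^ 2 ^ n * invPowSum (polyLT (d + 1)) n := by
  set B := (polyLT d).image fun v => v + RatFunc.X ^ d with hB
  have h0 : (0 : K) ∉ B := disjoint_left.1 (disjoint_polyLT d) (zero_mem_polyLT d)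
  have h1 : ∀ b ∈ B, ∀ b' ∈ B, b + b' ∈ polyLT d := by
    intro b hb b' hb'
    obtain ⟨a, ha, rfl⟩ := mem_image.1 hb
    obtain ⟨a', ha', rfl⟩ := mem_image.1 hb'
    have : a + RatFunc.X ^ d + (a' + RatFunc.X ^ d) = a + a' := by
      linear_combination RatFunc.X ^ d * CharTwo.two_eq_zero (R := K)
    rw [this]
    exact add_mem_polyLT ha ha'
  have h2 : ∀ v ∈ polyLT d, ∀ b ∈ B, v + b ∈ B := by
    intro v hv b hb
    obtain ⟨a, ha, rfl⟩ := mem_image.1 hb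
    exact mem_image.2 ⟨v + a, add_mem_polyLT hv ha, add_assoc _ _ _⟩
  have h := sum_torsor_invPow h1 h2 h0 (disjoint_polyLT d) n
  have h3 : ∑ b ∈ B, b⁻¹ = 1 / carlitzL d := by
    rw [hB, sum_image (add_left_injective _).injOn, sum_monic_inv]
  rw [h3] at h
  rw [polyLT, ← h, invPowSum, erase_union_distrib, erase_eq_of_notMem h0,
    sum_union ((disjoint_polyLT d).mono_left (erase_subset _ _)), invPowSum]

open Classical in
-- The number of nonzero elements is odd. For `polyLT 0` the sum is empty, whence the shift to d +
-- 1.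
theorem invPowSum_polyLT_zero (d : ℕ) : invPowSum (polyLT (d + 1)) 0 = 1 := by
  have h : ((polyLT (d + 1)).card : K) = 0 := by
    rw [polyLT, card_union_of_disjoint (disjoint_polyLT d),
      card_image_of_injective _ (add_left_injective _), Nat.cast_add, CharTwo.add_self_eq_zero]
  rw [invPowSum]
  simp only [pow_zero, Nat.sub_self, sum_const, nsmul_eq_mul, mul_one]
  rw [card_erase_of_mem (zero_mem_polyLT _), Nat.cast_sub (card_pos.2 ⟨0, zero_mem_polyLT _⟩), h,
    zero_sub, Nat.cast_one, CharTwo.neg_eq]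

open Classical in
-- Double induction on d and n; the recursion reduces to [d+n+2] = [n+1] + [d+1]^{2^{n+1}}.
theorem invPowSum_polyLT (d n : ℕ) :
    invPowSum (polyLT (d + 1)) n = carlitzL (d + n) / (carlitzL n * carlitzL d ^ 2 ^ n) := by
  have hL := carlitzL_ne_zero
  induction d generalizing n with
  | zero =>
    have h := hL n
    have : (polyLT 1).erase 0 = {1} := by
      ext a
      simp only [polyLT, mem_erase, mem_union, mem_singleton, image_singleton, pow_zero, zero_add]
      refine ⟨fun h => h.2.resolve_left h.1, ?_⟩
      rintro rfl
      simp
    rw [zero_add, invPowSum, this]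
    simp [carlitzL_zero, h]
  | succ d ihd =>
    induction n with
    | zero =>
      have := hL (d + 1)
      rw [invPowSum_polyLT_zero]
      simp [carlitzL_zero, this]
    | succ n ih =>
      rw [invPowSum_polyLT_succ, ihd, ih, show d + 1 + (n + 1) = d + n + 1 + 1 by ring,
        show d + 1 + n = d + n + 1 by ring, show d + (n + 1) = d + n + 1 by ring,
        carlitzL_succ (d + n + 1), carlitzL_succ d, carlitzL_succ n,
        show d + n + 1 + 1 = n + 1 + (d + 1) by ring, bracket_add (n + 1) (d + 1)]
      have h1 := hL d
      have h2 := hL n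
      have h3 := bracket_ne_zero (Nat.succ_ne_zero d)
      have h4 := bracket_ne_zero (Nat.succ_ne_zero n)
      rw [Nat.succ_eq_add_one] at h3 h4
      rw [mul_pow, mul_pow, div_pow, mul_pow, one_pow, pow_succ 2 n, pow_mul, pow_mul]
      field_simp
      ring

open Classical in
theorem invPowSum_ratio (d : ℕ) {n : ℕ} (hn : 1 ≤ n) :
    invPowSum (polyLT (d + 1)) n ≠ 0 ∧
    (invPowSum (polyLT (d + 1)) n ^ 2 + invPowSum (polyLT (d + 1)) (n - 1) ^ 2 *
        invPowSum (polyLT (d + 1)) 1 ^ 2 ^ n) / invPowSum (polyLT (d + 1)) n ^ 2 =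
      1 + (bracket n / bracket 1 ^ 2 ^ (n - 1)) ^ 2 *
        (bracket (d + 1) ^ 2 ^ (n - 1) / bracket (d + n)) ^ 2 := by
  obtain ⟨n, rfl⟩ := Nat.exists_eq_add_of_le' hn
  have hL := carlitzL_ne_zero
  have h1 := hL d
  have h2 := hL n
  have h3 := bracket_ne_zero (Nat.succ_ne_zero d)
  have h4 := bracket_ne_zero (Nat.succ_ne_zero n)
  have h5 := bracket_ne_zero (Nat.succ_ne_zero (d + n))
  have h6 := bracket_ne_zero one_ne_zero
  have h7 := hL (d + n)
  rw [Nat.succ_eq_add_one] at h3 h4 h5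
  simp only [invPowSum_polyLT, Nat.add_sub_cancel, ← add_assoc, carlitzL_succ d, carlitzL_succ n,
    carlitzL_succ (d + n)]
  have hL1 : carlitzL 1 = bracket 1 := by simp [carlitzL]
  refine ⟨by positivity, ?_⟩
  rw [hL1, pow_succ 2 n, pow_mul]
  simp only [mul_pow, div_pow, ← pow_mul, pow_one]
  field_simp
  ring

theorem bracket_pred_div (n : ℕ) (hn : 1 ≤ n) :
    bracket (n - 1) ^ 2 / bracket 1 ^ 2 ^ n = 1 + (bracket n / bracket 1 ^ 2 ^ (n - 1)) ^ 2 := by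
  obtain ⟨n, rfl⟩ := Nat.exists_eq_add_of_le' hn
  have h6 := bracket_ne_zero one_ne_zero
  rw [Nat.add_sub_cancel, bracket_add n 1, pow_succ 2 n, pow_mul]
  field_simp
  linear_combination -((bracket 1 ^ 2 ^ n) ^ 2 + bracket n * bracket 1 ^ 2 ^ n) *
    CharTwo.two_eq_zero (R := K)

end Carlitz

/-! ### Cancellation among pairs with a given product -/

section Exponents

variable {ι : Type*} [DecidableEq ι]

/-- Exchange the values of two exponent vectors at one place. -/
noncomputable def swapAt (q : ι) (p : (ι →₀ ℕ) × (ι →₀ ℕ)) : (ι →₀ ℕ) × (ι →₀ ℕ) :=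
  (p.1.update q (p.2 q), p.2.update q (p.1 q))

theorem swapAt_swapAt (q : ι) (p : (ι →₀ ℕ) × (ι →₀ ℕ)) : swapAt q (swapAt q p) = p := by
  obtain ⟨α, β⟩ := p
  simp only [swapAt]
  ext i <;> by_cases h : i = q <;> simp [h]

theorem swapAt_add (q : ι) (p : (ι →₀ ℕ) × (ι →₀ ℕ)) :
    (swapAt q p).1 + (swapAt q p).2 = p.1 + p.2 := by
  ext i
  by_cases h : i = q <;> simp [swapAt, h, add_comm]

theorem neLocus_swapAt (q : ι) (p : (ι →₀ ℕ) × (ι →₀ ℕ)) :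
    (swapAt q p).1.neLocus (swapAt q p).2 = p.1.neLocus p.2 := by
  ext i
  by_cases h : i = q <;> simp [swapAt, h, eq_comm]

end Exponents

section Exponents

variable {ι : Type*} [Nonempty ι]

/-- A choice of an element of a nonempty finite set. -/
noncomputable def pick (D : Finset ι) : ι :=
  Classical.epsilon (· ∈ D)

theorem pick_mem {D : Finset ι} (h : D.Nonempty) : pick D ∈ D :=
  Classical.epsilon_spec h

variable [DecidableEq ι]

/-- One of the two orientations of a pair of distinct exponent vectors: compare them at a chosen
place where they differ. -/
def Precedes (α β : ι →₀ ℕ) : Prop :=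
  α (pick (α.neLocus β)) < β (pick (α.neLocus β))

theorem Precedes.ne {α β : ι →₀ ℕ} (h : Precedes α β) : α ≠ β := by
  rintro rfl
  exact lt_irrefl _ h

theorem precedes_iff_not {α β : ι →₀ ℕ} (h : α ≠ β) : Precedes α β ↔ ¬ Precedes β α := by
  have h1 := Finsupp.mem_neLocus.1 (pick_mem (Finsupp.nonempty_neLocus_iff.2 h))
  rw [Precedes, Precedes, β.neLocus_comm α]
  omega

/-- In characteristic two, a sum over unordered pairs of exponent vectors of a function of their
sum reduces to the pairs which differ at one place only. -/
theorem sum_precedes {R : Type*} [CommRing R] [CharP R 2] (s : (ι →₀ ℕ) → Prop)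
    (E : Finset ((ι →₀ ℕ) × (ι →₀ ℕ))) (hE : ∀ p, p ∈ E ↔ Precedes p.1 p.2 ∧ s (p.1 + p.2))
    (T : Finset (ι × ℕ × (ι →₀ ℕ)))
    (hT : ∀ q, q ∈ T ↔ q.2.1 ≠ 0 ∧ s (q.2.2 + q.2.2 + Finsupp.single q.1 q.2.1))
    (g : (ι →₀ ℕ) → R) :
    ∑ p ∈ E, g (p.1 + p.2) = ∑ q ∈ T, g (q.2.2 + q.2.2 + Finsupp.single q.1 q.2.1) := by
  rw [← sum_filter_add_sum_filter_not E fun p => (p.1.neLocus p.2).card = 1]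
  have h0 : ∑ p ∈ E with ¬ (p.1.neLocus p.2).card = 1, g (p.1 + p.2) = 0 := by
    have hq : ∀ p ∈ E.filter fun p => ¬ (p.1.neLocus p.2).card = 1,
        pick ((p.1.neLocus p.2).erase (pick (p.1.neLocus p.2))) ∈
          (p.1.neLocus p.2).erase (pick (p.1.neLocus p.2)) := fun p hp => by
      rw [mem_filter, hE] at hp
      refine pick_mem (card_pos.1 ?_)
      have h1 := Finsupp.nonempty_neLocus_iff.2 hp.1.1.ne
      rw [card_erase_of_mem (pick_mem h1)]
      have := card_pos.2 h1
      have := hp.2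
      omega
    -- The swap is made at a differing place other than the one that decides the orientation. Both
    -- places depend only on the set of differing places, which the swap preserves, so it is an
    -- involution compatible with `Precedes`.
    refine sum_involution
      (fun p _ => swapAt (pick ((p.1.neLocus p.2).erase (pick (p.1.neLocus p.2)))) p) ?_ ?_ ?_ ?_
    · intro p _
      rw [swapAt_add, CharTwo.add_self_eq_zero]
    · intro p hp _ heq
      have h1 := hq p hp
      have h2 := Finsupp.mem_neLocus.1 (mem_erase.1 h1).2
      have h3 := DFunLike.congr_fun (congrArg Prod.fst heq)
        (pick ((p.1.neLocus p.2).erase (pick (p.1.neLocus p.2))))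
      simp only [swapAt, Finsupp.update_apply, if_true] at h3
      exact h2 h3.symm
    · intro p hp
      have h1 := (mem_erase.1 (hq p hp)).1
      rw [mem_filter, hE] at hp ⊢
      rw [swapAt_add, neLocus_swapAt, Precedes, neLocus_swapAt]
      refine ⟨⟨?_, hp.1.2⟩, hp.2⟩
      simp only [swapAt, Finsupp.update_apply, if_neg h1.symm]
      exact hp.1.1
    · intro p hp
      simp only [neLocus_swapAt, swapAt_swapAt]
  rw [h0, add_zero]
  have hne : ∀ (q : ι) (k : ℕ) (b : ι →₀ ℕ), k ≠ 0 →
      b.neLocus (b + Finsupp.single q k) = {q} := fun q k b hk => by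
    ext i
    by_cases h : i = q <;> simp [h, hk]
  symm
  refine sum_bij (fun q _ => (q.2.2, q.2.2 + Finsupp.single q.1 q.2.1)) ?_ ?_ ?_ ?_
  · rintro ⟨q, k, b⟩ h
    rw [hT] at h
    have h1 := hne q k b h.1
    have h2 : pick {q} = q := by simpa using pick_mem (singleton_nonempty q)
    rw [mem_filter, hE, Precedes, h1, h2]
    refine ⟨⟨?_, ?_⟩, card_singleton _⟩
    · have := h.1
      simp only [Finsupp.add_apply, Finsupp.single_eq_same] at this ⊢
      omega
    · rw [← add_assoc]
      exact h.2
  · rintro ⟨q, k, b⟩ h ⟨q', k', b'⟩ h' heq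
    rw [hT] at h h'
    simp only [Prod.mk.injEq] at heq h h'
    obtain ⟨rfl, h2⟩ := heq
    rcases Finsupp.single_eq_single_iff _ _ _ _ |>.1 (add_left_cancel h2) with ⟨rfl, rfl⟩ | h3
    · rfl
    · exact absurd h3.1 h.1
  · rintro ⟨α, β⟩ h
    rw [mem_filter, hE] at h
    obtain ⟨q, hq⟩ := card_eq_one.1 h.2
    have h2 : pick {q} = q := by simpa using pick_mem (singleton_nonempty q)
    have h1 := h.1.1
    simp only [Precedes] at h1 hq
    rw [hq, h2] at h1
    have hβ : β = α + Finsupp.single q (β q - α q) := by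
      ext i
      by_cases hi : i = q
      · subst hi
        simp
        omega
      · have : i ∉ α.neLocus β := by
          rw [hq]
          simpa using hi
        rw [Finsupp.mem_neLocus, not_not] at this
        simp [hi, this]
    refine ⟨(q, β q - α q, α), (hT _).2 ⟨by simp only; omega, ?_⟩, ?_⟩
    · simp only [add_assoc]
      rw [← hβ]
      exact h.1.2
    · simp only
      rw [← hβ]
  · rintro ⟨q, k, b⟩ -
    simp only [add_assoc]

end Exponents

/-! ### Polynomials over 𝔽₂ as exponent vectors -/

section Factorization

theorem monic_of_ne_zero {p : (ZMod 2)[X]} (hp : p ≠ 0) : p.Monic := by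
  have h : ∀ a : ZMod 2, a ≠ 0 → a = 1 := by decide
  exact h _ (leadingCoeff_ne_zero.2 hp)

instance : Nonempty MonicPrime :=
  ⟨⟨X, monic_X, irreducible_X⟩⟩

/-- The polynomial with given exponents at the monic primes. -/
noncomputable def primeProd (α : MonicPrime →₀ ℕ) : (ZMod 2)[X] :=
  α.prod fun P k => (P : (ZMod 2)[X]) ^ k

theorem primeProd_zero : primeProd 0 = 1 := Finsupp.prod_zero_index

theorem primeProd_add (α β : MonicPrime →₀ ℕ) :
    primeProd (α + β) = primeProd α * primeProd β := by
  classical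
  exact Finsupp.prod_add_index' (fun _ => pow_zero _) (fun _ _ _ => pow_add _ _ _)

theorem primeProd_single (P : MonicPrime) (k : ℕ) :
    primeProd (Finsupp.single P k) = (P : (ZMod 2)[X]) ^ k :=
  Finsupp.prod_single_index (pow_zero _)

theorem primeProd_monic (α : MonicPrime →₀ ℕ) : (primeProd α).Monic :=
  monic_prod_of_monic _ _ fun P _ => P.2.1.pow _

theorem primeProd_injective : Function.Injective primeProd := by
  classical
  have h : ∀ (α : MonicPrime →₀ ℕ) (P : MonicPrime),
      (UniqueFactorizationMonoid.normalizedFactors (primeProd α)).count (P : (ZMod 2)[X]) = α P := by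
    intro α P
    induction α using Finsupp.induction with
    | zero => simp [primeProd_zero]
    | single_add Q k α _ _ ih =>
      rw [primeProd_add, UniqueFactorizationMonoid.normalizedFactors_mul
        (primeProd_monic _).ne_zero (primeProd_monic _).ne_zero, Multiset.count_add, ih,
        primeProd_single, UniqueFactorizationMonoid.normalizedFactors_pow,
        UniqueFactorizationMonoid.normalizedFactors_irreducible Q.2.2, Q.2.1.normalize_eq_self,
        Multiset.count_nsmul, Multiset.count_singleton, Finsupp.add_apply, Finsupp.single_apply]
      congr 1
      by_cases hPQ : P = Q
      · simp [hPQ]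
      · rw [if_neg (fun h => hPQ (Subtype.ext h)), if_neg (Ne.symm hPQ), mul_zero]
  intro α β hαβ
  ext P
  rw [← h α, ← h β, hαβ]

theorem exists_primeProd_eq {p : (ZMod 2)[X]} (hp : p ≠ 0) : ∃ α, primeProd α = p := by
  induction p using WfDvdMonoid.induction_on_irreducible with
  | zero => exact absurd rfl hp
  | unit u hu => exact ⟨0, by rw [primeProd_zero, (monic_of_ne_zero hp).eq_one_of_isUnit hu]⟩
  | mul a q ha hq ih =>
    obtain ⟨α, rfl⟩ := ih ha
    exact ⟨Finsupp.single ⟨q, monic_of_ne_zero hq.ne_zero, hq⟩ 1 + α, by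
      rw [primeProd_add, primeProd_single, pow_one]⟩

theorem natDegree_primeProd_add (α β : MonicPrime →₀ ℕ) :
    (primeProd (α + β)).natDegree = (primeProd α).natDegree + (primeProd β).natDegree := by
  rw [primeProd_add, (primeProd_monic α).natDegree_mul (primeProd_monic β)]

theorem natDegree_primeProd_single (P : MonicPrime) (k : ℕ) :
    (primeProd (Finsupp.single P k)).natDegree = k * (P : (ZMod 2)[X]).natDegree := by
  rw [primeProd_single, natDegree_pow]

theorem mem_polyLT {d : ℕ} {v : K} :
    v ∈ polyLT d ↔ ∃ p : (ZMod 2)[X], p.degree < d ∧ algebraMap (ZMod 2)[X] K p = v := by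
  induction d generalizing v with
  | zero =>
    rw [polyLT, mem_singleton]
    constructor
    · rintro rfl
      exact ⟨0, by simp, map_zero _⟩
    · rintro ⟨p, hp, rfl⟩
      have : p = 0 := by simpa using hp
      rw [this, map_zero]
  | succ d ih =>
    simp only [polyLT, mem_union, mem_image, ih]
    constructor
    · rintro (⟨p, hp, rfl⟩ | ⟨_, ⟨p, hp, rfl⟩, rfl⟩)
      · exact ⟨p, hp.trans (by exact_mod_cast Nat.lt_succ_self d), rfl⟩
      · refine ⟨p + X ^ d, ?_, by simp⟩
        refine (degree_add_le _ _).trans_lt (max_lt (hp.trans ?_) ?_)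
        · exact_mod_cast Nat.lt_succ_self d
        · rw [degree_X_pow]
          exact_mod_cast Nat.lt_succ_self d
    · rintro ⟨p, hp, rfl⟩
      rcases lt_or_ge p.degree d with h | h
      · exact Or.inl ⟨p, h, rfl⟩
      · have hd : p.degree = d := le_antisymm (Order.lt_succ_iff.1 (by exact_mod_cast hp)) h
        have hp0 : p ≠ 0 := by
          rintro rfl
          simp at hd
        refine Or.inr ⟨algebraMap _ K (p - X ^ d), ⟨_, ?_, rfl⟩, by simp⟩
        rw [← hd]
        refine degree_sub_lt_left (by rw [hd, degree_X_pow]) hp0 ?_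
        rw [(monic_of_ne_zero hp0).leadingCoeff, leadingCoeff_X_pow]

/-- The rational function with given exponents at the monic primes. -/
noncomputable def primeFrac (α : MonicPrime →₀ ℕ) : K :=
  algebraMap (ZMod 2)[X] K (primeProd α)

theorem primeFrac_injective : Function.Injective primeFrac :=
  (RatFunc.algebraMap_injective _).comp primeProd_injective

theorem primeFrac_ne_zero (α : MonicPrime →₀ ℕ) : primeFrac α ≠ 0 :=
  RatFunc.algebraMap_ne_zero (primeProd_monic α).ne_zero

theorem primeFrac_mem_polyLT {α : MonicPrime →₀ ℕ} {d : ℕ} :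
    primeFrac α ∈ polyLT d ↔ (primeProd α).natDegree < d := by
  rw [natDegree_lt_iff_degree_lt (primeProd_monic α).ne_zero, mem_polyLT]
  refine ⟨?_, fun h => ⟨_, h, rfl⟩⟩
  rintro ⟨p, hp, h⟩
  rwa [← RatFunc.algebraMap_injective _ h]

theorem finite_natDegree_lt (d : ℕ) : {α | (primeProd α).natDegree < d}.Finite := by
  refine Set.Finite.subset ((polyLT d).finite_toSet.preimage primeFrac_injective.injOn)
    fun α h => ?_
  exact primeFrac_mem_polyLT.2 h

/-- The exponent vectors of the monic polynomials of degree less than `d`. -/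
noncomputable def exponentsLT (d : ℕ) : Finset (MonicPrime →₀ ℕ) :=
  (finite_natDegree_lt d).toFinset

theorem mem_exponentsLT {d : ℕ} {α : MonicPrime →₀ ℕ} :
    α ∈ exponentsLT d ↔ (primeProd α).natDegree < d := by
  simp [exponentsLT]

open Classical in
theorem polyLT_erase_zero (d : ℕ) : (polyLT d).erase 0 = (exponentsLT d).image primeFrac := by
  ext v
  rw [mem_erase, mem_image]
  constructor
  · rintro ⟨h0, hv⟩
    obtain ⟨p, -, rfl⟩ := mem_polyLT.1 hv
    obtain ⟨α, rfl⟩ := exists_primeProd_eq (p := p) (by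
      rintro rfl
      exact h0 (map_zero _))
    exact ⟨α, mem_exponentsLT.2 (primeFrac_mem_polyLT.1 hv), rfl⟩
  · rintro ⟨α, hα, rfl⟩
    exact ⟨primeFrac_ne_zero α, primeFrac_mem_polyLT.2 (mem_exponentsLT.1 hα)⟩

theorem finite_prime_natDegree_lt (d : ℕ) :
    {P : MonicPrime | (P : (ZMod 2)[X]).natDegree < d}.Finite := by
  refine Set.Finite.subset ((exponentsLT d).finite_toSet.preimage
    (f := fun P => Finsupp.single P 1) (fun a _ b _ h => Finsupp.single_left_injective one_ne_zero h))
    fun P h => ?_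
  rw [Set.mem_preimage, mem_coe, mem_exponentsLT, natDegree_primeProd_single, one_mul]
  exact h

/-- The monic primes of degree less than `d`. -/
noncomputable def primesLT (d : ℕ) : Finset MonicPrime :=
  (finite_prime_natDegree_lt d).toFinset

theorem mem_primesLT {d : ℕ} {P : MonicPrime} :
    P ∈ primesLT d ↔ (P : (ZMod 2)[X]).natDegree < d := by
  simp [primesLT]

end Factorization

/-! ### Estimates at infinity and the proof of part (III) -/

section Infinity

open WithZero

open Classical in
/-- The valuation of `𝔽₂(t)` at infinity. -/
noncomputable def vInfty : Valuation K (WithZero (Multiplicative ℤ)) :=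
  RatFunc.inftyValuation (ZMod 2)

theorem vInfty_algebraMap {p : (ZMod 2)[X]} (hp : p ≠ 0) :
    vInfty (algebraMap (ZMod 2)[X] K p) = exp (p.natDegree : ℤ) := by
  classical
  exact RatFunc.inftyValuation.polynomial (ZMod 2) hp

theorem hasSum_of_vInfty_sub_le {ι : Type*} {f : ι → K} {a : K}
    (h : ∀ d : ℕ, ∃ s : Finset ι, ∀ F, s ⊆ F → vInfty (∑ i ∈ F, f i - a) ≤ exp (-(d : ℤ))) :
    HasSum (fun i => algebraMap K KInfty (f i)) (algebraMap K KInfty a) := by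
  classical
  have hv : ∀ x : K, (Valued.v (algebraMap K KInfty x)) = vInfty x := fun x => by
    let := RatFunc.inftyValued (ZMod 2)
    exact Valued.extensionValuation_apply_coe x
  intro U hU
  obtain ⟨γ, hγ⟩ := Valued.mem_nhds.1 hU
  have hγ0 : MonoidWithZeroHom.ValueGroup₀.embedding γ.1 ≠ 0 := by simp
  -- With d at least 1 - log γ, exp(-d) is strictly below γ.
  obtain ⟨s, hs⟩ := h (1 - log (MonoidWithZeroHom.ValueGroup₀.embedding γ.1)).toNat
  refine Filter.mem_map.2 (Filter.mem_of_superset (Filter.mem_atTop s) fun F hF => hγ ?_)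
  beta_reduce
  rw [Set.mem_ofPred_eq, Valuation.restrict_lt_iff_lt_embedding, ← map_sum, ← map_sub, hv]
  refine (hs F hF).trans_lt ((exp_lt_exp.2 ?_).trans_eq (exp_log hγ0))
  omega

/-- The elements of `𝔽₂(t)` of absolute value at most `2^{-d}`. -/
noncomputable def smallSubgroup (d : ℕ) : AddSubgroup K where
  carrier := {x | vInfty x ≤ exp (-(d : ℤ))}
  zero_mem' := by simp
  add_mem' hx hy := (vInfty.map_add _ _).trans (max_le hx hy)
  neg_mem' hx := by simpa [Valuation.map_neg] using hx

theorem mem_smallSubgroup {d : ℕ} {x : K} : x ∈ smallSubgroup d ↔ vInfty x ≤ exp (-(d : ℤ)) :=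
  Iff.rfl

theorem mul_mem_smallSubgroup {d : ℕ} {x y : K} (hx : x ∈ smallSubgroup d) (hy : vInfty y ≤ 1) :
    x * y ∈ smallSubgroup d := by
  rw [mem_smallSubgroup, map_mul]
  exact (mul_le_of_le_one_right' hy).trans hx

theorem sum_sub_sum_mem {ι : Type*} [DecidableEq ι] {A : AddSubgroup K} {s t : Finset ι}
    (hst : s ⊆ t) {f : ι → K} (h : ∀ i ∈ t, i ∉ s → f i ∈ A) : ∑ i ∈ t, f i - ∑ i ∈ s, f i ∈ A := by
  rw [← sum_sdiff hst, add_sub_cancel_right]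
  exact A.sum_mem fun i hi => h i (mem_sdiff.1 hi).1 (mem_sdiff.1 hi).2

theorem vInfty_primeFrac (α : MonicPrime →₀ ℕ) :
    vInfty (primeFrac α) = exp ((primeProd α).natDegree : ℤ) :=
  vInfty_algebraMap (primeProd_monic α).ne_zero

theorem primeFrac_add (α β : MonicPrime →₀ ℕ) :
    primeFrac (α + β) = primeFrac α * primeFrac β := by
  rw [primeFrac, primeProd_add, map_mul, primeFrac, primeFrac]

theorem primeFrac_single (P : MonicPrime) (k : ℕ) :
    primeFrac (Finsupp.single P k) = algebraMap (ZMod 2)[X] K P ^ k := by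
  rw [primeFrac, primeProd_single, map_pow]

theorem inv_pow_mem_smallSubgroup {d m : ℕ} (hm : m ≠ 0) {α : MonicPrime →₀ ℕ}
    (h : d ≤ (primeProd α).natDegree) : (primeFrac α)⁻¹ ^ m ∈ smallSubgroup d := by
  rw [mem_smallSubgroup, map_pow, map_inv₀, vInfty_primeFrac, ← exp_neg, ← exp_nsmul, exp_le_exp,
    nsmul_eq_mul]
  have h1 : 1 ≤ m := Nat.one_le_iff_ne_zero.2 hm
  have h2 : 1 * d ≤ m * (primeProd α).natDegree := Nat.mul_le_mul h1 h
  have h3 : (1 * d : ℤ) ≤ m * (primeProd α).natDegree := by exact_mod_cast h2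
  linarith

theorem natDegree_prime_pos (P : MonicPrime) : 0 < (P : (ZMod 2)[X]).natDegree :=
  P.2.2.natDegree_pos

/-- The sum over products of pairs, up to terms of large degree. -/
theorem sum_pairs_sub_mem [DecidableEq MonicPrime] [DecidableRel (Precedes (ι := MonicPrime))]
    (d : ℕ) {m : ℕ} (hm : m ≠ 0) :
    ∑ p ∈ exponentsLT d ×ˢ exponentsLT d with Precedes p.1 p.2,
        ((primeFrac p.1)⁻¹ * (primeFrac p.2)⁻¹) ^ m -
      (∑ P ∈ primesLT d, ∑ k ∈ Icc 1 d, ((algebraMap (ZMod 2)[X] K P)⁻¹ ^ m) ^ k) *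
        (∑ α ∈ exponentsLT d, (primeFrac α)⁻¹ ^ m) ^ 2 ∈ smallSubgroup d := by
  -- Restricting both sums to products of degree less than d makes the cancellation exact; each
  -- discarded term is small.
  set s : (MonicPrime →₀ ℕ) → Prop := fun γ => (primeProd γ).natDegree < d with hs
  set g : (MonicPrime →₀ ℕ) → K := fun γ => (primeFrac γ)⁻¹ ^ m with hg
  set E := (exponentsLT d ×ˢ exponentsLT d).filter fun p => Precedes p.1 p.2 ∧ s (p.1 + p.2) with hE
  set T₀ := primesLT d ×ˢ Icc 1 d ×ˢ exponentsLT d with hT₀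
  set T := T₀.filter fun q => s (q.2.2 + q.2.2 + Finsupp.single q.1 q.2.1) with hT
  have h1 : ∑ p ∈ E, g (p.1 + p.2) =
      ∑ q ∈ T, g (q.2.2 + q.2.2 + Finsupp.single q.1 q.2.1) := by
    refine sum_precedes s E (fun p => ?_) T (fun q => ?_) g
    · simp only [hE, hs, mem_filter, mem_product, mem_exponentsLT, natDegree_primeProd_add]
      refine ⟨fun h => h.2, fun h => ⟨⟨by omega, by omega⟩, h⟩⟩
    · simp only [hT, hT₀, hs, mem_filter, mem_product, mem_exponentsLT, natDegree_primeProd_add,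
        natDegree_primeProd_single, mem_primesLT, mem_Icc]
      have hP := natDegree_prime_pos q.1
      refine ⟨fun h => ⟨by omega, h.2⟩, fun h => ?_⟩
      have h2 : q.2.1 * 1 ≤ q.2.1 * (q.1 : (ZMod 2)[X]).natDegree := Nat.mul_le_mul_left _ hP
      have h3 : 1 * (q.1 : (ZMod 2)[X]).natDegree ≤ q.2.1 * (q.1 : (ZMod 2)[X]).natDegree :=
        Nat.mul_le_mul_right _ (Nat.one_le_iff_ne_zero.2 h.1)
      omega
  have h2 : ∑ p ∈ exponentsLT d ×ˢ exponentsLT d with Precedes p.1 p.2,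
      ((primeFrac p.1)⁻¹ * (primeFrac p.2)⁻¹) ^ m =
        ∑ p ∈ exponentsLT d ×ˢ exponentsLT d with Precedes p.1 p.2, g (p.1 + p.2) :=
    sum_congr rfl fun p _ => by simp only [hg, primeFrac_add, mul_inv]
  have h3 : (∑ P ∈ primesLT d, ∑ k ∈ Icc 1 d, ((algebraMap (ZMod 2)[X] K P)⁻¹ ^ m) ^ k) *
      (∑ α ∈ exponentsLT d, (primeFrac α)⁻¹ ^ m) ^ 2 =
        ∑ q ∈ T₀, g (q.2.2 + q.2.2 + Finsupp.single q.1 q.2.1) := by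
    rw [sum_pow_char, hT₀, sum_product, sum_mul]
    refine sum_congr rfl fun P _ => ?_
    rw [sum_product, sum_mul_sum]
    refine sum_congr rfl fun k _ => sum_congr rfl fun b _ => ?_
    simp only [hg, primeFrac_add, primeFrac_single, mul_inv, mul_pow, ← pow_mul, inv_pow]
    ring
  have h4 : ∑ p ∈ exponentsLT d ×ˢ exponentsLT d with Precedes p.1 p.2, g (p.1 + p.2) -
      ∑ p ∈ E, g (p.1 + p.2) ∈ smallSubgroup d := by
    refine sum_sub_sum_mem ?_ fun p hp hp' => ?_
    · intro p hp
      rw [hE, mem_filter] at hp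
      exact mem_filter.2 ⟨hp.1, hp.2.1⟩
    · rw [mem_filter] at hp
      refine inv_pow_mem_smallSubgroup hm (not_lt.1 fun h => hp' ?_)
      exact mem_filter.2 ⟨hp.1, hp.2, h⟩
  have h5 : ∑ q ∈ T₀, g (q.2.2 + q.2.2 + Finsupp.single q.1 q.2.1) -
      ∑ q ∈ T, g (q.2.2 + q.2.2 + Finsupp.single q.1 q.2.1) ∈ smallSubgroup d := by
    refine sum_sub_sum_mem (filter_subset _ _) fun p hp hp' => ?_
    exact inv_pow_mem_smallSubgroup hm (not_lt.1 fun h => hp' (mem_filter.2 ⟨hp, h⟩))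
  rw [h2, h3]
  have h6 := (smallSubgroup d).sub_mem h4 h5
  rwa [h1, sub_sub_sub_cancel_right] at h6

theorem vInfty_inv_prime_pow_lt {P : MonicPrime} {m : ℕ} (hm : m ≠ 0) :
    vInfty ((algebraMap (ZMod 2)[X] K P)⁻¹ ^ m) < 1 := by
  rw [map_pow, map_inv₀, vInfty_algebraMap P.2.1.ne_zero, ← exp_neg]
  refine pow_lt_one₀ zero_le ?_ hm
  rw [← exp_zero, exp_lt_exp]
  have := natDegree_prime_pos P
  omega

theorem one_div_one_sub_pow {P : MonicPrime} {m : ℕ} :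
    1 / (1 - algebraMap (ZMod 2)[X] K P ^ m) =
      (algebraMap (ZMod 2)[X] K P)⁻¹ ^ m * ((algebraMap (ZMod 2)[X] K P)⁻¹ ^ m - 1)⁻¹ := by
  have h : algebraMap (ZMod 2)[X] K P ≠ 0 := RatFunc.algebraMap_ne_zero P.2.1.ne_zero
  rw [inv_pow, one_div, ← mul_inv_rev, sub_mul, inv_mul_cancel₀ (pow_ne_zero _ h), one_mul,
    inv_inj]

theorem vInfty_sub_one_inv {y : K} (hy : vInfty y < 1) : vInfty ((y - 1)⁻¹) = 1 := by
  rw [map_inv₀, Valuation.map_sub_eq_of_lt_right _ (by rwa [map_one]), map_one, inv_one]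

theorem one_div_mem_smallSubgroup {P : MonicPrime} {m d : ℕ} (hm : m ≠ 0)
    (hP : d ≤ (P : (ZMod 2)[X]).natDegree) :
    1 / (1 - algebraMap (ZMod 2)[X] K P ^ m) ∈ smallSubgroup d := by
  rw [one_div_one_sub_pow]
  refine mul_mem_smallSubgroup ?_ (vInfty_sub_one_inv (vInfty_inv_prime_pow_lt hm)).le
  have h := inv_pow_mem_smallSubgroup (α := Finsupp.single P 1) hm (d := d)
    (by rwa [natDegree_primeProd_single, one_mul])
  rwa [primeFrac_single, pow_one] at h

/-- With y = P^{-m}, the left term is y/(y-1), in characteristic 2 the geometric series starting at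
y; the remainder is y^{d+1}/(y-1). -/
theorem one_div_sub_sum_mem {P : MonicPrime} {m d : ℕ} (hm : m ≠ 0) :
    1 / (1 - algebraMap (ZMod 2)[X] K P ^ m) -
      ∑ k ∈ Icc 1 d, ((algebraMap (ZMod 2)[X] K P)⁻¹ ^ m) ^ k ∈ smallSubgroup d := by
  have h1 := vInfty_inv_prime_pow_lt (P := P) hm
  set y := (algebraMap (ZMod 2)[X] K P)⁻¹ ^ m with hy
  have h0 : y - 1 ≠ 0 := by
    intro h
    rw [sub_eq_zero.1 h, map_one] at h1
    exact lt_irrefl _ h1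
  have h2 : 1 / (1 - algebraMap (ZMod 2)[X] K P ^ m) - ∑ k ∈ Icc 1 d, y ^ k =
      y ^ d * (y * (y - 1)⁻¹) := by
    have h3 : ∑ k ∈ Icc 1 d, y ^ k = (y ^ (d + 1) - y) * (y - 1)⁻¹ := by
      rw [← Ico_add_one_right_eq_Icc, geom_sum_Ico (sub_ne_zero.1 h0) (by omega), pow_one,
        div_eq_mul_inv]
    rw [one_div_one_sub_pow, ← hy, h3]
    linear_combination (y * (y - 1)⁻¹ - y ^ d * y * (y - 1)⁻¹) * CharTwo.two_eq_zero (R := K)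
  rw [h2]
  refine mul_mem_smallSubgroup ?_ ?_
  · have h := inv_pow_mem_smallSubgroup (α := Finsupp.single P d) hm (d := d) (by
      rw [natDegree_primeProd_single]
      exact Nat.le_mul_of_pos_right _ (natDegree_prime_pos P))
    rwa [primeFrac_single, ← inv_pow, pow_right_comm] at h
  · rw [map_mul, vInfty_sub_one_inv h1, mul_one]
    exact h1.le

/-- The polynomial 1 dominates. Hence dividing by the square of this sum loses no precision. -/
theorem vInfty_sum_exponentsLT {d m : ℕ} (hd : 1 ≤ d) (hm : m ≠ 0) :
    vInfty (∑ α ∈ exponentsLT d, (primeFrac α)⁻¹ ^ m) = 1 := by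
  classical
  have h0 : (0 : MonicPrime →₀ ℕ) ∈ exponentsLT d := by
    rw [mem_exponentsLT, primeProd_zero, natDegree_one]
    omega
  rw [← add_sum_erase _ _ h0, primeFrac, primeProd_zero, map_one, inv_one, one_pow]
  have h : ∑ α ∈ (exponentsLT d).erase 0, (primeFrac α)⁻¹ ^ m ∈ smallSubgroup 1 := by
    refine (smallSubgroup 1).sum_mem fun α hα => inv_pow_mem_smallSubgroup hm ?_
    refine Nat.one_le_iff_ne_zero.2 fun h => (mem_erase.1 hα).1 (primeProd_injective ?_)
    rw [primeProd_zero]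
    exact (primeProd_monic α).natDegree_eq_zero.1 h
  rw [Valuation.map_add_eq_of_lt_left _ ?_, map_one]
  rw [map_one]
  refine (mem_smallSubgroup.1 h).trans_lt ?_
  rw [← exp_zero, exp_lt_exp]
  norm_num

theorem sum_primesLT_sub_mem {n d : ℕ} (hn : 1 ≤ n) :
    ∑ P ∈ primesLT (d + 1), 1 / (1 - algebraMap (ZMod 2)[X] K P ^ (2 ^ n - 1)) -
      (1 + (bracket n / bracket 1 ^ 2 ^ (n - 1)) ^ 2 *
        (bracket (d + 1) ^ 2 ^ (n - 1) / bracket (d + n)) ^ 2) ∈ smallSubgroup (d + 1) := by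
  classical
  have hm : 2 ^ n - 1 ≠ 0 := (Nat.sub_pos_of_lt (Nat.one_lt_two_pow (by omega))).ne'
  obtain ⟨h0, h1⟩ := invPowSum_ratio d hn
  have h2 := sum_pairs_invPow (exponentsLT (d + 1)) primeFrac primeFrac_injective.injOn
    (fun α _ => primeFrac_ne_zero α) Precedes (fun _ _ _ _ h => precedes_iff_not h)
    (fun _ _ h => h.ne rfl) (polyLT_erase_zero (d + 1))
    (fun _ hv _ hw => add_mem_polyLT hv hw) hn
  have h3 : invPowSum (polyLT (d + 1)) n =
      ∑ α ∈ exponentsLT (d + 1), (primeFrac α)⁻¹ ^ (2 ^ n - 1) := by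
    rw [invPowSum, polyLT_erase_zero, sum_image primeFrac_injective.injOn]
  have h4 := sum_pairs_sub_mem (d + 1) hm
  have h5 := vInfty_sum_exponentsLT (d := d + 1) (by omega) hm
  rw [← h3] at h4 h5
  have h6 : (∑ P ∈ primesLT (d + 1), 1 / (1 - algebraMap (ZMod 2)[X] K P ^ (2 ^ n - 1))) -
      ∑ P ∈ primesLT (d + 1), ∑ k ∈ Icc 1 (d + 1),
        ((algebraMap (ZMod 2)[X] K P)⁻¹ ^ (2 ^ n - 1)) ^ k ∈ smallSubgroup (d + 1) := by
    rw [← sum_sub_distrib]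
    exact (smallSubgroup _).sum_mem fun P _ => one_div_sub_sum_mem hm
  have h7 := mul_mem_smallSubgroup h4
    (y := (invPowSum (polyLT (d + 1)) n ^ 2)⁻¹) (by rw [map_inv₀, map_pow, h5]; simp)
  rw [h2, sub_mul, mul_assoc, mul_inv_cancel₀ (pow_ne_zero 2 h0), mul_one, ← div_eq_mul_inv, h1]
    at h7
  have h8 := (smallSubgroup _).sub_mem h6 h7
  rwa [sub_sub_sub_cancel_right] at h8

theorem vInfty_bracket {n : ℕ} (hn : n ≠ 0) : vInfty (bracket n) = exp (2 ^ n : ℤ) := by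
  have hX : vInfty RatFunc.X = exp 1 := by
    have h := vInfty_algebraMap (p := X) X_ne_zero
    rwa [RatFunc.algebraMap_X, natDegree_X] at h
  have h1 : vInfty (RatFunc.X ^ 2 ^ n) = exp (2 ^ n : ℤ) := by
    rw [map_pow, hX, ← exp_nsmul]
    simp
  rw [bracket, Valuation.map_sub_eq_of_lt_left _ ?_, h1]
  rw [h1, hX, exp_lt_exp]
  exact_mod_cast Nat.one_lt_two_pow hn

theorem vInfty_bracket_le (n : ℕ) : vInfty (bracket n) ≤ exp (2 ^ n : ℤ) := by
  rcases eq_or_ne n 0 with rfl | hn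
  · simp [bracket_zero]
  · exact (vInfty_bracket hn).le

/-- The ratio r = [d+1]^{2^{n-1}}/[d+n] differs from 1 by [n-1]/[d+n], which tends to 0. -/
theorem ratio_sub_mem {n : ℕ} (hn : 1 ≤ n) (d : ℕ) :
    1 + (bracket n / bracket 1 ^ 2 ^ (n - 1)) ^ 2 *
        (bracket (d + 1) ^ 2 ^ (n - 1) / bracket (d + n)) ^ 2 -
      bracket (n - 1) ^ 2 / bracket 1 ^ 2 ^ n ∈ smallSubgroup d := by
  have hA : vInfty (bracket n / bracket 1 ^ 2 ^ (n - 1)) = 1 := by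
    rw [map_div₀, map_pow, vInfty_bracket (by omega), vInfty_bracket one_ne_zero, ← exp_nsmul,
      ← exp_sub, ← exp_zero]
    congr 1
    obtain ⟨n, rfl⟩ := Nat.exists_eq_add_of_le' hn
    simp [pow_succ]
  have hB : vInfty (bracket (d + 1) ^ 2 ^ (n - 1) / bracket (d + n) - 1) ≤ exp (-(d : ℤ)) := by
    have h1 : bracket (d + 1) ^ 2 ^ (n - 1) / bracket (d + n) - 1 =
        -(bracket (n - 1) / bracket (d + n)) := by
      have h2 := bracket_ne_zero (n := d + n) (by omega)
      have h3 := bracket_add (n - 1) (d + 1)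
      rw [show n - 1 + (d + 1) = d + n by omega] at h3
      field_simp
      linear_combination -h3
    rw [h1, Valuation.map_neg, map_div₀, vInfty_bracket (n := d + n) (by omega)]
    refine (div_le_div_of_nonneg_right (vInfty_bracket_le (n - 1)) zero_le).trans ?_
    rw [← exp_sub, exp_le_exp]
    have h4 : 2 ^ (n - 1) + d ≤ 2 ^ (d + n) := by
      have h5 := Nat.lt_two_pow_self (n := d + 1)
      have h6 : 1 ≤ 2 ^ (n - 1) := Nat.one_le_two_pow
      rw [show d + n = n - 1 + (d + 1) by omega, pow_add 2 (n - 1)]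
      nlinarith
    have h7 : (2 : ℤ) ^ (n - 1) + d ≤ 2 ^ (d + n) := by exact_mod_cast h4
    linarith
  -- In characteristic 2, r^2 - 1 = (r - 1)^2.
  have h := mul_mem_smallSubgroup (mem_smallSubgroup.2 hB)
    (y := (bracket (d + 1) ^ 2 ^ (n - 1) / bracket (d + n) - 1) *
      (bracket n / bracket 1 ^ 2 ^ (n - 1)) ^ 2) (by
        rw [map_mul, map_pow, hA, one_pow, mul_one]
        refine hB.trans ?_
        rw [← exp_zero, exp_le_exp]
        omega)
  rw [bracket_pred_div n hn]
  convert h using 1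
  linear_combination (bracket n / bracket 1 ^ 2 ^ (n - 1)) ^ 2 *
    (bracket (d + 1) ^ 2 ^ (n - 1) / bracket (d + n) - 1) * CharTwo.two_eq_zero (R := K)

theorem hasSum_primes {n : ℕ} (hn : 1 ≤ n) :
    HasSum (fun P : MonicPrime => algebraMap K KInfty
        (1 / (1 - algebraMap (Polynomial (ZMod 2)) K (P : Polynomial (ZMod 2)) ^ (2 ^ n - 1))))
      (algebraMap K KInfty (bracket (n - 1) ^ 2 / bracket 1 ^ 2 ^ n)) := by
  classical
  have hm : 2 ^ n - 1 ≠ 0 := (Nat.sub_pos_of_lt (Nat.one_lt_two_pow (by omega))).ne'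
  refine hasSum_of_vInfty_sub_le fun d => ⟨primesLT (d + 1), fun F hF => ?_⟩
  rw [← mem_smallSubgroup]
  have hle : smallSubgroup (d + 1) ≤ smallSubgroup d := fun x hx => by
    refine (mem_smallSubgroup.1 hx).trans (exp_le_exp.2 ?_)
    push_cast
    linarith
  have h1 := hle (sum_sub_sum_mem (A := smallSubgroup (d + 1)) hF
    (f := fun P => 1 / (1 - algebraMap (ZMod 2)[X] K P ^ (2 ^ n - 1)))
    fun P _ hP => one_div_mem_smallSubgroup hm (not_lt.1 fun h => hP (mem_primesLT.2 h)))
  have h2 := hle (sum_primesLT_sub_mem (d := d) hn)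
  have h3 := (smallSubgroup d).add_mem ((smallSubgroup d).add_mem h1 h2) (ratio_sub_mem hn d)
  rwa [sub_add_sub_cancel, sub_add_sub_cancel] at h3

end Infinity

end PrimeSymmetry

open PrimeSymmetry in
theorem mainTheorem1 (n : ℕ) (hn : 1 ≤ n) :
    -- (I)
    (∃ Q : MvPolynomial ℕ+ ℤ,
      IsElementaryExpression (2 ^ n - 1) Q ∧
      (∀ Q' : MvPolynomial ℕ+ ℤ, IsElementaryExpression (2 ^ n - 1) Q' → Q' = Q) ∧
      mersennePart (MvPolynomial.map (Int.castRingHom (ZMod 2)) Q) =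
        xSeq (eVar (ZMod 2)) n ^ 2) ∧
    -- the equivalent recursion for `X_n` that does not mention the `f_k`
    xSeq (eVar (ZMod 2)) n =
      ∑ k ∈ Finset.range (n - 1), eVar (ZMod 2) (2 ^ (n - k) - 1) ^ 2 ^ k *
        (eVar (ZMod 2) 1 ^ (∑ i ∈ Finset.range k, 2 ^ i) +
          ∑ j ∈ Finset.Icc 1 k,
            eVar (ZMod 2) 1 ^ (∑ i ∈ Finset.Ico j k, 2 ^ i) * xSeq (eVar (ZMod 2)) j) ∧
    -- (II), the substitution in the formula for `X_n`
    (∀ e f : ℕ → K, (∀ i, 1 ≤ i → e (2 ^ i - 1) = 1 / carlitzD i) →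
      (∀ i, f i = 1 / carlitzL i) →
        xFormula e f n = bracket (n - 1) / (carlitzL n * bracket 1 ^ 2 ^ (n - 1))) ∧
    -- the two substitutions are compatible: the first one turns each polynomial `f_k` into `1 / L_k`
    (∀ v : ℕ+ → K, (∀ (i : ℕ+) (k : ℕ), (i : ℕ) = 2 ^ k - 1 → v i = 1 / carlitzD k) →
      ∀ k, MvPolynomial.aeval v (fSeq (eVar (ZMod 2)) k) = 1 / carlitzL k) ∧
    -- (III)
    HasSum
      (fun P : MonicPrime =>
        algebraMap K KInfty
          (1 / (1 - algebraMap (Polynomial (ZMod 2)) K (P : Polynomial (ZMod 2)) ^ (2 ^ n - 1))))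
      (algebraMap K KInfty
        (bracket (n - 1) ^ 2 / bracket 1 ^ 2 ^ n)) := by
  have hm : 0 < 2 ^ n - 1 := Nat.sub_pos_of_lt (Nat.one_lt_two_pow (by omega))
  obtain ⟨Q, hQ⟩ := exists_isElementaryExpression hm
  refine ⟨⟨Q, hQ, fun Q' hQ' => hQ.unique hQ', mersennePart_eq hn hQ⟩, xSeq_eq_sum _ n,
    fun e f he hf => xFormula_carlitz hn he hf, fun v hv k => ?_, hasSum_primes hn⟩
  rw [← RingHom.coe_coe, map_fSeq]
  refine fSeq_eq_one_div_carlitzL (fun i hi => ?_) k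
  have h0 : 0 < 2 ^ i - 1 := Nat.sub_pos_of_lt (Nat.one_lt_two_pow (by omega))
  rw [eVar, dif_pos h0, RingHom.coe_coe]
  exact (MvPolynomial.aeval_X _ _).trans (hv _ i rfl)
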